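/- Consider the message-passing model: $k$ sites $P_1,\dots,P_k$ exchange bits over private point-to-point channels (a message from $P_i$ to $P_j$ is not seen by the other sites), the transcript specifies who speaks next and to whom and which site finally reports the answer, and every bit sent by a site, as well as the answer it reports, depends only on its own input, its random tape and the messages it has itself sent and received (and, for a bit, on its addressee). The cost of a randomized protocol is the maximal total number of bits exchanged, over all possible inputs and all contents of the random tapes (which may be private or shared). For a decision problem $f$, let $R^{1/3}(f)$ be the least cost of a randomized protocol that, on every possible input, reports the correct value of $f$ with error probability at most $1/3$. In the bipartiteness problem with edge duplication, site $P_i$ holds a graph $G_i$ on the common vertex set $[n]$; the same edge may occur at several sites. The sites have to decide whether the union $G=G_1\cup\dots\cup G_k$ is bipartite. The possible inputs are those for which $G$ has $m\ge n$ edges. **Theorem.** There are absolute constants $c_0>0$ and $c>0$ such that for all integers $k\ge 2$ and $n$ with $c_0\log_2 n\le k\le n$, $$R^{1/3}(\text{bipartiteness with edge duplication})\;\ge\; c\cdot\frac{kn}{\log_2 k}.$$ -/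

import Mathlib

open scoped ENNReal

/-- A one-bit message sent over the channel from site `sender` to site `receiver`.
A longer message is a sequence of one-bit messages. -/
structure Message (k : ℕ) where
  sender : Fin k
  receiver : Fin k
  bit : Bool

/-- The list of all messages exchanged so far, in chronological order. -/
abbrev Transcript (k : ℕ) : Type := List (Message k)

/-- What site `i` sees of a transcript: exactly the messages that it sent or received itself.
Communication is point-to-point, so it does not see the messages between other sites. -/
def localView {k : ℕ} (i : Fin k) (t : Transcript k) : List (Message k) :=
  t.filter fun m => m.sender = i ∨ m.receiver = i

/-- A deterministic protocol in the message-passing model with `k` sites, each of which holds an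
input from `X`.  The transcript specifies who speaks next (and to whom), when the protocol stops
and which site then reports the answer, while the bit that a site sends and the answer that it
reports depend only on its own input and its own view (and on the addressee of the bit).
Sites are computationally unbounded. -/
structure Protocol (k : ℕ) (X : Type) where
  /-- the next speaker and the site it speaks to; `none` means that the communication is over -/
  next : Transcript k → Option (Fin k × Fin k)
  /-- the bit that site `i`, with the given input and view, sends to the given receiver -/
  message : (i : Fin k) → X → List (Message k) → (receiver : Fin k) → Bool
  /-- the site that reports the answer at the end -/
  reporter : Transcript k → Fin k
  /-- the answer that site `i`, with the given input and view, reports -/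
  answer : (i : Fin k) → X → List (Message k) → Bool

namespace Protocol

variable {k : ℕ} {X : Type}

/-- The transcript on input `x` after `s` steps; it does not change any more once the
communication is over. -/
def transcript (P : Protocol k X) (x : Fin k → X) : ℕ → Transcript k
  | 0 => []
  | s + 1 =>
    match P.next (P.transcript x s) with
    | none => P.transcript x s
    | some (i, j) =>
      P.transcript x s ++
        [⟨i, j, P.message i (x i) (localView i (P.transcript x s)) j⟩]

/-- The number of bits exchanged on input `x` (`⊤` if the protocol does not stop). -/
noncomputable def cost (P : Protocol k X) (x : Fin k → X) : ℕ∞ :=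
  ⨆ s : ℕ, ((P.transcript x s).length : ℕ∞)

/-- On input `x` the protocol stops and the reported answer is the truth value of `f x`. -/
def Correct (P : Protocol k X) (f : (Fin k → X) → Prop) (x : Fin k → X) : Prop :=
  ∃ s : ℕ, P.next (P.transcript x s) = none ∧
    (P.answer (P.reporter (P.transcript x s)) (x (P.reporter (P.transcript x s)))
      (localView (P.reporter (P.transcript x s)) (P.transcript x s)) = true ↔ f x)

end Protocol

/-- A randomized protocol: `ω : Ω` is the joint content of the random tapes of all sites, and
fixing it leaves a deterministic protocol.  Private tapes are the case of a product space in which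
site `i` uses the `i`-th coordinate only; tapes that are shared among the sites are allowed. -/
structure RandomizedProtocol (k : ℕ) (X : Type) where
  Ω : Type
  [measurableSpace : MeasurableSpace Ω]
  law : MeasureTheory.Measure Ω
  [isProbabilityMeasure : MeasureTheory.IsProbabilityMeasure law]
  fixTapes : Ω → Protocol k X

namespace RandomizedProtocol

variable {k : ℕ} {X : Type}

attribute [instance] measurableSpace isProbabilityMeasure

/-- The maximal number of bits exchanged, over all possible inputs and all random tapes. -/
noncomputable def cost (P : RandomizedProtocol k X) (inputs : Set (Fin k → X)) : ℕ∞ :=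
  ⨆ x ∈ inputs, ⨆ ω : P.Ω, (P.fixTapes ω).cost x

/-- On every possible input, `P` decides `f` with error probability at most `δ`. -/
def ComputesWithError (P : RandomizedProtocol k X) (inputs : Set (Fin k → X))
    (f : (Fin k → X) → Prop) (δ : ℝ≥0∞) : Prop :=
  ∀ x ∈ inputs, P.law {ω | ¬ (P.fixTapes ω).Correct f x} ≤ δ

end RandomizedProtocol

/-- The randomized `δ`-error communication complexity `R^δ(f)` of a decision problem `f` on a set
of possible inputs: the least cost of a randomized protocol with error probability at most `δ`. -/
noncomputable def randomizedCC {k : ℕ} {X : Type} (δ : ℝ≥0∞) (inputs : Set (Fin k → X))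
    (f : (Fin k → X) → Prop) : ℕ∞ :=
  ⨅ (P : RandomizedProtocol k X) (_ : P.ComputesWithError inputs f δ), P.cost inputs

/-- The graph on the vertex set `Fin n` that is stored at `k` sites: the union of the local
graphs.  The same edge may occur at any number of sites. -/
def unionGraph {k n : ℕ} (G : Fin k → SimpleGraph (Fin n)) : SimpleGraph (Fin n) :=
  ⨆ i, G i

/-- The inputs of a graph problem with edge duplication: arbitrary local graphs whose union
has `m ≥ n` edges. -/
def graphInputs (k n : ℕ) : Set (Fin k → SimpleGraph (Fin n)) :=
  {G | n ≤ (unionGraph G).edgeSet.ncard}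

/-- The bipartiteness problem: is the union of the local graphs bipartite? -/
def Bipartiteness (k n : ℕ) (G : Fin k → SimpleGraph (Fin n)) : Prop :=
  (unionGraph G).IsBipartite

/-! The problem contains many set-disjointness instances that share one player. Site `0` holds a set
y and the other m = k - 1 sites hold sets x_i, all inside a universe of size r = ⌊n/4⌋. An element j
of x_i ∩ y creates the triangle 0, 1, 2 + j, and if every x_i misses y the union is bipartite. Draw
y, and given y draw the x_i independently so that each pair (x_i, y) follows `disjointWeight`; the
answer should then be "bipartite". With C bits exchanged the views have total length at most 2C, so
most sites see at most L = O(C/k) messages, and there are only k^{O(L)} such short views.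

Fix a site i, its view, whether it reports, and a positive answer. By cut-and-paste
(`transcript_update`, `answerAt_update`) these inputs form a rectangle between x_i and everything
else; averaging over the other sites given y turns it into a product f(x_i) g(y). By
`corruption_bound` its mass under `uniqueWeight`, where the pair meets in one point, is at least
9/10 of its mass under `disjointWeight`, up to e^{-r/2000}. Summed over short views, resampling x_i
to meet y once keeps the now wrong positive answer too often (`Protocol.sum_error_ge`), unless the
number of views is exponential in n. Hence L log k = Ω(n), that is, C = Ω(kn / log k).

For the corruption bound, both distributions are generated from a random split D, Dᶜ of the
universe. For each i the two masses are compared over the splits D and D ∪ {i}; the discrepancy is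
governed by the squared biases of f and g at i. Their sum over i is at most an entropy deficiency
(`sum_sq_subsetBias_le`), which is small compared with r unless the rectangle is exponentially
small. -/

/-! ### The corruption bound for set disjointness -/

/-- The sum of `f` over the subsets of `D`. -/
def subsetSum {α : Type*} (f : Finset α → ℝ) (D : Finset α) : ℝ := ∑ x ∈ D.powerset, f x

/-- The normalized difference of the sums of `f` over the subsets of `D` that contain `i`, and
over those that do not. -/
noncomputable def subsetBias {α : Type*} [DecidableEq α] (f : Finset α → ℝ) (D : Finset α)
    (i : α) : ℝ :=
  (subsetSum f D - 2 * subsetSum f (D.erase i)) / subsetSum f D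

/-! ### The level-one inequality for weighted families of sets -/

section Level

variable {α : Type*} {f : Finset α → ℝ}

theorem subsetSum_nonneg (hf : ∀ x, 0 ≤ f x) (D : Finset α) : 0 ≤ subsetSum f D :=
  Finset.sum_nonneg fun x _ => hf x

theorem subsetSum_mono (hf : ∀ x, 0 ≤ f x) {D E : Finset α} (h : D ⊆ E) :
    subsetSum f D ≤ subsetSum f E :=
  Finset.sum_le_sum_of_subset_of_nonneg (Finset.powerset_mono.2 h) fun x _ _ => hf x

variable [DecidableEq α]

theorem subsetSum_erase (D : Finset α) (i : α) :
    subsetSum f (D.erase i) = ∑ x ∈ D.powerset, if i ∈ x then 0 else f x := by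
  have h : (D.erase i).powerset = D.powerset.filter fun x => i ∉ x := by
    ext x
    simp only [Finset.mem_powerset, Finset.mem_filter, Finset.subset_erase]
  rw [subsetSum, h, Finset.sum_filter]
  exact Finset.sum_congr rfl fun x _ => by split_ifs <;> simp_all

theorem subsetSum_insert_sub (D : Finset α) {i : α} (hi : i ∉ D) :
    subsetSum f (insert i D) - subsetSum f D =
      ∑ x ∈ (insert i D).powerset, if i ∈ x then f x else 0 := by
  have h := subsetSum_erase (f := f) (insert i D) i
  rw [Finset.erase_insert hi] at h
  rw [h, subsetSum, ← Finset.sum_sub_distrib]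
  exact Finset.sum_congr rfl fun x _ => by split_ifs <;> ring

/-- No positivity of the total is needed: if it vanishes, monotonicity makes the other sum vanish
too, so the value of the division by zero is harmless. -/
theorem subsetBias_mul (hf : ∀ x, 0 ≤ f x) (D : Finset α) (i : α) :
    subsetBias f D i * subsetSum f D = subsetSum f D - 2 * subsetSum f (D.erase i) := by
  rcases (subsetSum_nonneg hf D).eq_or_lt with h | h
  · have h1 := subsetSum_mono hf (D.erase_subset i)
    have h2 := subsetSum_nonneg hf (D.erase i)
    rw [← h] at h1
    rw [← h, le_antisymm h1 h2]
    simp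
  · rw [subsetBias, div_mul_cancel₀ _ h.ne']

theorem abs_subsetBias_le (hf : ∀ x, 0 ≤ f x) (D : Finset α) (i : α) :
    |subsetBias f D i| ≤ 1 := by
  have h1 := subsetSum_mono hf (D.erase_subset i)
  have h2 := subsetSum_nonneg hf (D.erase i)
  rw [subsetBias, abs_div, abs_of_nonneg (subsetSum_nonneg hf D)]
  refine div_le_one_of_le₀ (abs_le.2 ⟨?_, ?_⟩) (subsetSum_nonneg hf D) <;> linarith

theorem sum_mul_sum_sign (D : Finset α) (b : α → ℝ) :
    ∑ x ∈ D.powerset, f x * ∑ i ∈ D, (if i ∈ x then b i else -b i) =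
      ∑ i ∈ D, b i * (subsetSum f D - 2 * subsetSum f (D.erase i)) := by
  simp_rw [Finset.mul_sum]
  rw [Finset.sum_comm]
  refine Finset.sum_congr rfl fun i _ => ?_
  rw [subsetSum_erase, subsetSum, mul_sub, Finset.mul_sum, Finset.mul_sum, Finset.mul_sum,
    ← Finset.sum_sub_distrib]
  exact Finset.sum_congr rfl fun x _ => by split_ifs <;> ring

/-- The signs of different elements are independent, so the sum factors into terms 2 cosh(b i), and
cosh b ≤ exp(b² / 2). -/
theorem sum_exp_sum_sign_le (D : Finset α) (b : α → ℝ) :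
    ∑ x ∈ D.powerset, Real.exp (∑ i ∈ D, (if i ∈ x then b i else -b i)) ≤
      2 ^ D.card * Real.exp ((∑ i ∈ D, b i ^ 2) / 2) := by
  have h : ∑ x ∈ D.powerset, Real.exp (∑ i ∈ D, (if i ∈ x then b i else -b i)) =
      ∏ i ∈ D, (Real.exp (b i) + Real.exp (-b i)) := by
    rw [Finset.prod_add]
    refine Finset.sum_congr rfl fun x hx => ?_
    rw [Finset.mem_powerset] at hx
    rw [Real.exp_sum, ← Finset.prod_sdiff hx, mul_comm]
    congr 1
    · exact Finset.prod_congr rfl fun i hi => by rw [if_pos hi]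
    · exact Finset.prod_congr rfl fun i hi => by rw [if_neg (Finset.mem_sdiff.1 hi).2]
  rw [h, Finset.sum_div, Real.exp_sum, ← Finset.prod_const, ← Finset.prod_mul_distrib]
  refine Finset.prod_le_prod (fun i _ => by positivity) fun i _ => ?_
  have := Real.cosh_le_exp_half_sq (b i)
  rw [Real.cosh_eq] at this
  linarith

/-- The level-one inequality: a large family of subsets of `D` has small total squared bias. -/
theorem sum_sq_subsetBias_le (hf : ∀ x, 0 ≤ f x) (hf1 : ∀ x, f x ≤ 1) (D : Finset α)
    (hD : 0 < subsetSum f D) :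
    ∑ i ∈ D, subsetBias f D i ^ 2 ≤ 2 * Real.log (2 ^ D.card / subsetSum f D) := by
  set b := subsetBias f D
  set m := ∑ i ∈ D, b i ^ 2
  set Z : Finset α → ℝ := fun x => ∑ i ∈ D, (if i ∈ x then b i else -b i)
  have hZ : ∑ x ∈ D.powerset, f x * Z x = m * subsetSum f D := by
    rw [sum_mul_sum_sign, Finset.sum_mul]
    refine Finset.sum_congr rfl fun i _ => ?_
    rw [← subsetBias_mul hf]
    ring
  -- Jensen for the weights `f`: the tangent line of exp at `m`, the `f`-mean of `Z`, followed by `f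
  -- ≤ 1`.
  have h1 : Real.exp m * subsetSum f D ≤ ∑ x ∈ D.powerset, Real.exp (Z x) := by
    calc Real.exp m * subsetSum f D
        = ∑ x ∈ D.powerset, f x * (Real.exp m * (Z x - m + 1)) := by
          have : ∀ x, f x * (Real.exp m * (Z x - m + 1)) =
            Real.exp m * (f x * Z x) + Real.exp m * (1 - m) * f x := fun x => by ring
          simp_rw [this, Finset.sum_add_distrib, ← Finset.mul_sum]
          rw [hZ, subsetSum]
          ring
      _ ≤ ∑ x ∈ D.powerset, Real.exp (Z x) := by
          refine Finset.sum_le_sum fun x _ => ?_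
          have h2 : Real.exp m * (Z x - m + 1) ≤ Real.exp (Z x) := by
            calc _ ≤ Real.exp m * Real.exp (Z x - m) := by
                  gcongr
                  exact Real.add_one_le_exp _
              _ = Real.exp (Z x) := by rw [← Real.exp_add]; ring_nf
          calc _ ≤ f x * Real.exp (Z x) := mul_le_mul_of_nonneg_left h2 (hf x)
            _ ≤ 1 * Real.exp (Z x) := by gcongr; exact hf1 x
            _ = _ := one_mul _
  have h3 := h1.trans (sum_exp_sum_sign_le D b)
  have h4 : Real.exp (m / 2) ≤ 2 ^ D.card / subsetSum f D := by
    rw [le_div_iff₀ hD]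
    have h5 : Real.exp m = Real.exp (m / 2) * Real.exp (m / 2) := by
      rw [← Real.exp_add]; ring_nf
    rw [h5] at h3
    have := Real.exp_pos (m / 2)
    nlinarith
  have := (Real.le_log_iff_exp_le (by positivity)).2 h4
  linarith

end Level

/-- For b and c near 0 both main terms are near 1, and the loss linear in b + c is absorbed by 1/20
plus a quadratic error. The factors 1 - c and 1 - b attach each squared bias to the mass of the
split in which its element lies on the biased side. -/
theorem balanced_mul_lower_bound {b c : ℝ} (hb : |b| ≤ 1) (hc : |c| ≤ 1) :
    19 / 20 * ((1 - b) + (1 - c)) / 2 - 25 * (b ^ 2 * (1 - c) + c ^ 2 * (1 - b)) ≤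
      (1 + b) * (1 + c) := by
  obtain ⟨hb1, hb2⟩ := abs_le.1 hb
  obtain ⟨hc1, hc2⟩ := abs_le.1 hc
  have hu : (b + c) ^ 2 * (2 - (b + c)) / 4 ≤ b ^ 2 * (1 - c) + c ^ 2 * (1 - b) := by
    nlinarith [mul_nonneg (sq_nonneg (b - c)) (by linarith : (0 : ℝ) ≤ 2 + (b + c))]
  have hu0 : 0 ≤ b ^ 2 * (1 - c) + c ^ 2 * (1 - b) := by
    have := mul_nonneg (sq_nonneg b) (sub_nonneg.2 hc2)
    have := mul_nonneg (sq_nonneg c) (sub_nonneg.2 hb2)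
    linarith
  have hp : b * c * (2 + (b + c)) = (b + c) ^ 2 - (b ^ 2 * (1 - c) + c ^ 2 * (1 - b)) := by ring
  set u := b ^ 2 * (1 - c) + c ^ 2 * (1 - b)
  rcases le_or_gt (-1) (b + c) with hs | hs
  · have hbc : -u ≤ b * c := by
      by_contra h
      push Not at h
      nlinarith [sq_nonneg (b + c)]
    rcases le_or_gt 0 (b + c) with h0 | h0
    · nlinarith
    · have : (b + c) ^ 2 / 2 ≤ u := by nlinarith [sq_nonneg (b + c)]
      -- The remaining quadratic in b + c has negative discriminant; -1/16 is close to its vertex.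
      nlinarith [sq_nonneg (b + c + 1 / 16)]
  · have hbc : 0 ≤ b * c := mul_nonneg_of_nonpos_of_nonpos (by linarith) (by linarith)
    have : (3 : ℝ) / 4 ≤ u := by nlinarith
    nlinarith

/-- Smooth form of a dichotomy: either log(R/Q) ≤ θ, or Q is below R exp(-θ). It follows from log t
≤ t - 1 at t = R exp(-θ) / Q. -/
theorem mul_log_le {Q R θ : ℝ} (hQ : 0 ≤ Q) (hR : 0 < R) :
    Q * Real.log (R / Q) ≤ θ * Q + R * Real.exp (-θ) := by
  rcases hQ.eq_or_lt with rfl | hQ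
  · simp; positivity
  · have h1 : Real.log (R / Q) = Real.log (R * Real.exp (-θ) / Q) + θ := by
      rw [mul_div_right_comm, Real.log_mul (by positivity) (Real.exp_pos _).ne', Real.log_exp]
      ring
    have h2 := Real.log_le_sub_one_of_pos (x := R * Real.exp (-θ) / Q) (by positivity)
    have h3 : Q * (R * Real.exp (-θ) / Q) = R * Real.exp (-θ) := by field_simp
    rw [h1]
    nlinarith

/-! ### Disjoint and uniquely intersecting pairs, generated by a random split -/

section Corruption

variable {α : Type*} [DecidableEq α] [Fintype α]

/-- The number of ways to separate `x` and `y`, up to normalization. -/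
noncomputable def pairWeight (x y : Finset α) : ℝ :=
  (1 / 4) ^ Fintype.card α * 2 ^ ((x ∪ y)ᶜ).card

/-- The distribution on disjoint pairs of sets in which every element belongs to `x` only or to
`y` only with probability `1 / 4` each. -/
noncomputable def disjointWeight (x y : Finset α) : ℝ :=
  if Disjoint x y then pairWeight x y else 0

/-- The corresponding distribution on pairs of sets that share exactly one element. -/
noncomputable def uniqueWeight (x y : Finset α) : ℝ :=
  if (x ∩ y).card = 1 then 4 / Fintype.card α * pairWeight x y else 0

/-- The separating sets form the interval from x to yᶜ. -/
theorem card_separators (x y : Finset α) :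
    ((Finset.univ.filter fun D : Finset α => x ⊆ D ∧ y ⊆ Dᶜ).card : ℝ) =
      if Disjoint x y then 2 ^ ((x ∪ y)ᶜ).card else 0 := by
  have h : (Finset.univ.filter fun D : Finset α => x ⊆ D ∧ y ⊆ Dᶜ) = Finset.Icc x yᶜ := by
    ext D
    simp only [Finset.mem_filter, Finset.mem_univ, true_and, Finset.mem_Icc]
    exact and_congr_right fun _ => by
      rw [← Finset.compl_subset_compl, compl_compl]
  rw [h]
  split_ifs with hd
  · rw [Finset.card_Icc_finset (Finset.subset_compl_iff_disjoint_right.2 hd), Finset.compl_union,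
      Finset.inter_comm, ← Finset.sdiff_eq_inter_compl, Finset.card_sdiff_of_subset
        (Finset.subset_compl_iff_disjoint_right.2 hd)]
    simp
  · rw [Finset.Icc_eq_empty (fun hxy => hd (Finset.subset_compl_iff_disjoint_right.1 hxy))]
    simp

theorem sum_sum_sum_comm {ι κ μ : Type*} [Fintype ι] [Fintype κ] [Fintype μ]
    (F : ι → κ → μ → ℝ) : ∑ i, ∑ x, ∑ y, F i x y = ∑ x, ∑ y, ∑ i, F i x y := by
  rw [Finset.sum_comm]
  exact Finset.sum_congr rfl fun x _ => Finset.sum_comm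

theorem ite_and_mul_zero {p q : Prop} [Decidable p] [Decidable q] (a b : ℝ) :
    (if p ∧ q then a * b else 0) = (if p then a else 0) * (if q then b else 0) := by
  by_cases hp : p <;> by_cases hq : q <;> simp [hp, hq]

theorem subsetSum_eq_sum_ite (f : Finset α → ℝ) (D : Finset α) :
    subsetSum f D = ∑ x, if x ⊆ D then f x else 0 := by
  rw [subsetSum, ← Finset.sum_filter, Finset.filter_subset_univ]

/-- `disjointWeight` is the law of independent uniform subsets of D and of Dᶜ for a uniform D; this
exposes the product structure for each fixed D. -/
theorem sum_disjointWeight (f g : Finset α → ℝ) :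
    ∑ x, ∑ y, disjointWeight x y * (f x * g y) =
      (1 / 4) ^ Fintype.card α * ∑ D, subsetSum f D * subsetSum g Dᶜ := by
  have h : ∀ D : Finset α, subsetSum f D * subsetSum g Dᶜ =
      ∑ x, ∑ y, if x ⊆ D ∧ y ⊆ Dᶜ then f x * g y else 0 := by
    intro D
    rw [subsetSum_eq_sum_ite, subsetSum_eq_sum_ite, Finset.sum_mul_sum]
    simp only [ite_and_mul_zero]
  simp_rw [h]
  rw [sum_sum_sum_comm, Finset.mul_sum]
  refine Finset.sum_congr rfl fun x _ => ?_
  rw [Finset.mul_sum]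
  refine Finset.sum_congr rfl fun y _ => ?_
  rw [← Finset.sum_filter, Finset.sum_const, nsmul_eq_mul, card_separators, disjointWeight,
    pairWeight]
  split_ifs <;> ring

/-- Only the common element i can contribute. Erasing it from x makes the pair disjoint without
changing the union, so `card_separators` applies. -/
theorem card_unique_separators (x y : Finset α) :
    (∑ i, ∑ D : Finset α,
        if (i ∈ x ∧ x.erase i ⊆ D) ∧ i ∈ y ∧ y ⊆ Dᶜ then (1 : ℝ) else 0) =
      if (x ∩ y).card = 1 then 2 ^ ((x ∪ y)ᶜ).card else 0 := by
  have h : ∀ i, (∑ D : Finset α,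
      if (i ∈ x ∧ x.erase i ⊆ D) ∧ i ∈ y ∧ y ⊆ Dᶜ then (1 : ℝ) else 0) =
      if x ∩ y = {i} then 2 ^ ((x ∪ y)ᶜ).card else 0 := by
    intro i
    by_cases hi : i ∈ x ∧ i ∈ y
    · simp only [hi.1, hi.2, true_and]
      rw [Finset.sum_boole, card_separators]
      have h1 : x.erase i ∪ y = x ∪ y := by
        ext j
        by_cases hj : j = i <;> simp_all
      have h2 : Disjoint (x.erase i) y ↔ x ∩ y = {i} := by
        rw [Finset.disjoint_left, Finset.ext_iff]
        constructor
        · intro h j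
          by_cases hj : j = i
          · simp_all
          · simp only [Finset.mem_inter, Finset.mem_singleton, hj, iff_false]
            exact fun hj' => h (Finset.mem_erase.2 ⟨hj, hj'.1⟩) hj'.2
        · intro h j hj hjy
          rw [Finset.mem_erase] at hj
          exact hj.1 (Finset.mem_singleton.1 ((h j).1 (Finset.mem_inter.2 ⟨hj.2, hjy⟩)))
      simp only [h1, h2]
    · rw [if_neg, Finset.sum_eq_zero]
      · intro D _
        rw [if_neg fun h => hi ⟨h.1.1, h.2.1⟩]
      · intro h
        have := Finset.mem_inter.1 (h ▸ Finset.mem_singleton_self i : i ∈ x ∩ y)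
        exact hi this
  simp_rw [h]
  split_ifs with hc
  · obtain ⟨a, ha⟩ := Finset.card_eq_one.1 hc
    rw [ha, Finset.sum_eq_single a]
    · simp
    · intro b _ hb
      rw [if_neg fun h => hb (Finset.singleton_injective h).symm]
    · simp
  · refine Finset.sum_eq_zero fun i _ => if_neg fun h => hc ?_
    rw [h, Finset.card_singleton]

theorem subsetSum_sub_mul_subsetSum_sub (f g : Finset α → ℝ) (i : α) (D : Finset α) :
    (∑ x, ∑ y, if (i ∈ x ∧ x.erase i ⊆ D) ∧ i ∈ y ∧ y ⊆ Dᶜ then f x * g y else 0) =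
      if i ∈ D then 0 else
        (subsetSum f (insert i D) - subsetSum f D) *
          (subsetSum g Dᶜ - subsetSum g (Dᶜ.erase i)) := by
  split_ifs with hi
  · refine Finset.sum_eq_zero fun x _ => Finset.sum_eq_zero fun y _ => if_neg fun h => ?_
    exact Finset.mem_compl.1 (h.2.2 h.2.1) hi
  · have h1 : subsetSum g Dᶜ - subsetSum g (Dᶜ.erase i) =
        ∑ y, if i ∈ y ∧ y ⊆ Dᶜ then g y else 0 := by
      have h := subsetSum_insert_sub (f := g) (Dᶜ.erase i) (Finset.notMem_erase i _)
      rw [Finset.insert_erase (Finset.mem_compl.2 hi)] at h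
      rw [h, ← Finset.sum_filter, ← Finset.sum_filter]
      refine Finset.sum_congr ?_ fun _ _ => rfl
      ext y
      simp [and_comm]
    have h2 : subsetSum f (insert i D) - subsetSum f D =
        ∑ x, if i ∈ x ∧ x.erase i ⊆ D then f x else 0 := by
      rw [subsetSum_insert_sub D hi, ← Finset.sum_filter, ← Finset.sum_filter]
      refine Finset.sum_congr ?_ fun _ _ => rfl
      ext x
      simp [and_comm, Finset.subset_insert_iff]
    rw [h1, h2, Finset.sum_mul_sum]
    simp only [ite_and_mul_zero]

theorem sum_uniqueWeight (f g : Finset α → ℝ) :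
    ∑ x, ∑ y, uniqueWeight x y * (f x * g y) =
      4 / Fintype.card α * (1 / 4) ^ Fintype.card α * ∑ i, ∑ D, if i ∈ D then 0 else
        (subsetSum f (insert i D) - subsetSum f D) *
          (subsetSum g Dᶜ - subsetSum g (Dᶜ.erase i)) := by
  simp_rw [← subsetSum_sub_mul_subsetSum_sub]
  have h : ∀ (F : α → Finset α → Finset α → Finset α → ℝ),
      ∑ i, ∑ D, ∑ x, ∑ y, F i D x y = ∑ x, ∑ y, ∑ i, ∑ D, F i D x y := by
    intro F
    exact (Finset.sum_congr rfl fun i _ => sum_sum_sum_comm (F i)).trans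
      (sum_sum_sum_comm fun i x y => ∑ D, F i D x y)
  rw [h, Finset.mul_sum]
  refine Finset.sum_congr rfl fun x _ => ?_
  rw [Finset.mul_sum]
  refine Finset.sum_congr rfl fun y _ => ?_
  have h2 := card_unique_separators x y
  have h3 : ∀ (i : α) (D : Finset α),
      (if (i ∈ x ∧ x.erase i ⊆ D) ∧ i ∈ y ∧ y ⊆ Dᶜ then f x * g y else 0) =
      (f x * g y) * if (i ∈ x ∧ x.erase i ⊆ D) ∧ i ∈ y ∧ y ⊆ Dᶜ then (1 : ℝ) else 0 := by
    intro i D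
    rw [mul_ite, mul_one, mul_zero]
  simp_rw [h3, ← Finset.mul_sum]
  rw [h2, uniqueWeight, pairWeight]
  split_ifs <;> ring

/-- With b and c the biases at i of f on D ∪ {i} and of g on Dᶜ, every sum is a multiple of the same
product of totals, which reduces the claim to `balanced_mul_lower_bound`. -/
theorem four_mul_sub_mul_sub_ge {f g : Finset α → ℝ} (hf : ∀ x, 0 ≤ f x) (hg : ∀ x, 0 ≤ g x)
    {i : α} {D : Finset α} (hi : i ∉ D) :
    19 / 20 * (subsetSum f D * subsetSum g Dᶜ +
        subsetSum f (insert i D) * subsetSum g (insert i D)ᶜ) -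
      50 * (subsetBias f (insert i D) i ^ 2 *
          (subsetSum f (insert i D) * subsetSum g (insert i D)ᶜ) +
        subsetBias g Dᶜ i ^ 2 * (subsetSum f D * subsetSum g Dᶜ)) ≤
      4 * ((subsetSum f (insert i D) - subsetSum f D) *
        (subsetSum g Dᶜ - subsetSum g (Dᶜ.erase i))) := by
  have h1 := subsetBias_mul hf (insert i D) i
  have h2 := subsetBias_mul hg Dᶜ i
  rw [Finset.erase_insert hi] at h1
  rw [Finset.compl_insert]
  have h3 := balanced_mul_lower_bound (abs_subsetBias_le hf (insert i D) i)
    (abs_subsetBias_le hg Dᶜ i)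
  have h4 := mul_nonneg (subsetSum_nonneg hf (insert i D)) (subsetSum_nonneg hg Dᶜ)
  have h5 := mul_le_mul_of_nonneg_left h3 h4
  have e1 : subsetSum f D = (1 - subsetBias f (insert i D) i) * subsetSum f (insert i D) / 2 := by
    linarith
  have e2 : subsetSum g (Dᶜ.erase i) = (1 - subsetBias g Dᶜ i) * subsetSum g Dᶜ / 2 := by
    linarith
  rw [e1, e2]
  linarith

theorem sum_eq_sum_erase (i : α) (F : Finset α → ℝ) :
    ∑ D, F D = ∑ D ∈ (Finset.univ.erase i).powerset, (F D + F (insert i D)) := by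
  rw [Finset.sum_add_distrib, ← Finset.sum_powerset_insert (Finset.notMem_erase i _),
    Finset.insert_erase (Finset.mem_univ i), Finset.powerset_univ]

/-- Pairs each D avoiding i with D ∪ {i}, so that each set is counted once. -/
theorem sum_ite_mem_add (i : α) (F : Finset α → ℝ) :
    ∑ D, (if i ∈ D then 0 else (F D + F (insert i D))) = ∑ D, F D := by
  rw [sum_eq_sum_erase i, sum_eq_sum_erase i F]
  refine Finset.sum_congr rfl fun D hD => ?_
  have : i ∉ D := fun h => by simpa using Finset.mem_powerset.1 hD h
  simp [this]

/-- Level-one inequalities on D for f and on Dᶜ for g; their logarithms add up to log(2^r / Q) for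
the product Q of the totals, and `mul_log_le` linearizes Q log(2^r / Q). -/
theorem mul_sum_sq_subsetBias_le {f g : Finset α → ℝ} (hf : ∀ x, 0 ≤ f x) (hf1 : ∀ x, f x ≤ 1)
    (hg : ∀ x, 0 ≤ g x) (hg1 : ∀ x, g x ≤ 1) (θ : ℝ) (D : Finset α) :
    (∑ i, if i ∈ D then subsetBias f D i ^ 2 * (subsetSum f D * subsetSum g Dᶜ) else
        subsetBias g Dᶜ i ^ 2 * (subsetSum f D * subsetSum g Dᶜ)) ≤
      2 * (θ * (subsetSum f D * subsetSum g Dᶜ) + 2 ^ Fintype.card α * Real.exp (-θ)) := by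
  have hQ := mul_nonneg (subsetSum_nonneg hf D) (subsetSum_nonneg hg Dᶜ)
  have h1 := mul_log_le (θ := θ) hQ (show (0 : ℝ) < 2 ^ Fintype.card α by positivity)
  refine le_trans ?_ (mul_le_mul_of_nonneg_left h1 zero_le_two)
  rw [← Finset.sum_add_sum_compl D,
    Finset.sum_congr rfl fun i (hi : i ∈ D) => if_pos hi,
    Finset.sum_congr rfl fun i (hi : i ∈ Dᶜ) => if_neg (Finset.mem_compl.1 hi),
    ← Finset.sum_mul, ← Finset.sum_mul]
  rcases (subsetSum_nonneg hf D).eq_or_lt with h0 | hF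
  · simp [← h0]
  rcases (subsetSum_nonneg hg Dᶜ).eq_or_lt with h0 | hG
  · simp [← h0]
  have h2 := sum_sq_subsetBias_le hf hf1 D hF
  have h3 := sum_sq_subsetBias_le hg hg1 Dᶜ hG
  have h4 : Real.log (2 ^ Fintype.card α / (subsetSum f D * subsetSum g Dᶜ)) =
      Real.log (2 ^ D.card / subsetSum f D) + Real.log (2 ^ Dᶜ.card / subsetSum g Dᶜ) := by
    rw [← Real.log_mul (by positivity) (by positivity), ← Finset.card_add_card_compl D, pow_add,
      mul_div_mul_comm]
  rw [h4]
  nlinarith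

theorem four_mul_sum_ge {f g : Finset α → ℝ} (hf : ∀ x, 0 ≤ f x) (hf1 : ∀ x, f x ≤ 1)
    (hg : ∀ x, 0 ≤ g x) (hg1 : ∀ x, g x ≤ 1) (θ : ℝ) :
    (19 / 20 * Fintype.card α - 100 * θ) * ∑ D, subsetSum f D * subsetSum g Dᶜ -
        100 * (4 ^ Fintype.card α * Real.exp (-θ)) ≤
      4 * ∑ i, ∑ D, if i ∈ D then 0 else
        (subsetSum f (insert i D) - subsetSum f D) *
          (subsetSum g Dᶜ - subsetSum g (Dᶜ.erase i)) := by
  set Q : Finset α → ℝ := fun D => subsetSum f D * subsetSum g Dᶜ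
  set R : α → Finset α → ℝ := fun i D =>
    if i ∈ D then subsetBias f D i ^ 2 * Q D else subsetBias g Dᶜ i ^ 2 * Q D
  have h1 : ∑ i, ∑ D, (19 / 20 * Q D - 50 * R i D) ≤
      4 * ∑ i, ∑ D, if i ∈ D then 0 else
        (subsetSum f (insert i D) - subsetSum f D) *
          (subsetSum g Dᶜ - subsetSum g (Dᶜ.erase i)) := by
    rw [Finset.mul_sum]
    refine Finset.sum_le_sum fun i _ => ?_
    rw [← sum_ite_mem_add i, Finset.mul_sum]
    refine Finset.sum_le_sum fun D _ => ?_
    split_ifs with hi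
    · simp
    · have h := four_mul_sub_mul_sub_ge hf hg hi
      have e1 : R i D = subsetBias g Dᶜ i ^ 2 * Q D := if_neg hi
      have e2 : R i (insert i D) = subsetBias f (insert i D) i ^ 2 * Q (insert i D) :=
        if_pos (Finset.mem_insert_self i D)
      rw [e1, e2]
      linarith
  refine le_trans ?_ h1
  have h2 : ∑ i, ∑ D, R i D ≤
      2 * (θ * ∑ D, Q D + 4 ^ Fintype.card α * Real.exp (-θ)) := by
    rw [Finset.sum_comm]
    refine (Finset.sum_le_sum fun D _ => mul_sum_sq_subsetBias_le hf hf1 hg hg1 θ D).trans ?_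
    rw [← Finset.mul_sum, Finset.sum_add_distrib, ← Finset.mul_sum, Finset.sum_const,
      Finset.card_univ, Fintype.card_finset, nsmul_eq_mul]
    have : (4 : ℝ) ^ Fintype.card α = 2 ^ Fintype.card α * 2 ^ Fintype.card α := by
      rw [← mul_pow]; norm_num
    rw [this]
    push_cast
    linarith
  simp_rw [Finset.sum_sub_distrib, ← Finset.mul_sum]
  rw [Finset.sum_const, Finset.card_univ, nsmul_eq_mul]
  linarith

/-- The corruption bound: a rectangle that contains many disjoint pairs contains almost as many
pairs that share exactly one element. -/
theorem corruption_bound (h100 : 100 ≤ Fintype.card α) {f g : Finset α → ℝ}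
    (hf : ∀ x, 0 ≤ f x) (hf1 : ∀ x, f x ≤ 1) (hg : ∀ x, 0 ≤ g x) (hg1 : ∀ x, g x ≤ 1) :
    9 / 10 * ∑ x, ∑ y, disjointWeight x y * (f x * g y) -
        Real.exp (-(Fintype.card α / 2000 : ℝ)) ≤
      ∑ x, ∑ y, uniqueWeight x y * (f x * g y) := by
  -- θ = r/2000 makes 100θ = r/20, leaving 19/20 - 1/20 = 9/10; the factor 100 on the exponential is
  -- later absorbed by r ≥ 100.
  have h := four_mul_sum_ge hf hf1 hg hg1 (Fintype.card α / 2000 : ℝ)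
  rw [sum_disjointWeight, sum_uniqueWeight]
  set r := Fintype.card α
  have hr : (100 : ℝ) ≤ r := by exact_mod_cast h100
  set A := ∑ D, subsetSum f D * subsetSum g Dᶜ
  set B := ∑ i, ∑ D, if i ∈ D then 0 else
        (subsetSum f (insert i D) - subsetSum f D) *
          (subsetSum g Dᶜ - subsetSum g (Dᶜ.erase i))
  set E := Real.exp (-(r / 2000 : ℝ))
  have hE : 0 < E := Real.exp_pos _
  have h4 : (1 / 4 : ℝ) ^ r * 4 ^ r = 1 := by rw [← mul_pow]; norm_num
  have hp : (0 : ℝ) < (1 / 4) ^ r := by positivity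
  have h5 := mul_le_mul_of_nonneg_left h hp.le
  have h6 : r * (9 / 10 * ((1 / 4) ^ r * A)) - 100 * E ≤ 4 * (1 / 4) ^ r * B := by
    have : (1 / 4 : ℝ) ^ r * (100 * (4 ^ r * E)) = 100 * E := by
      linear_combination 100 * E * h4
    linarith
  have h7 : 4 / (r : ℝ) * (1 / 4) ^ r * B = (4 * (1 / 4) ^ r * B) / r := by ring
  rw [h7, le_div_iff₀ (by linarith)]
  nlinarith

theorem sum_disjointWeight_eq_one : ∑ x : Finset α, ∑ y, disjointWeight x y = 1 := by
  have h := sum_disjointWeight (α := α) (fun _ => 1) (fun _ => 1)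
  simp only [mul_one, subsetSum, Finset.sum_const, Finset.card_powerset, nsmul_eq_mul] at h
  rw [h]
  push_cast
  simp_rw [← pow_add, Finset.card_add_card_compl]
  rw [Finset.sum_const, Finset.card_univ, Fintype.card_finset, nsmul_eq_mul]
  push_cast
  rw [← mul_pow, ← mul_pow]
  norm_num

theorem sum_uniqueWeight_eq_one [Nonempty α] : ∑ x : Finset α, ∑ y, uniqueWeight x y = 1 := by
  have h := sum_uniqueWeight (α := α) (fun _ => 1) (fun _ => 1)
  simp only [mul_one] at h
  rw [h]
  have hs : ∀ D : Finset α, subsetSum (fun _ => 1) D = 2 ^ D.card := fun D => by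
    simp [subsetSum]
  have h2 : ∀ i : α, (∑ D, if i ∈ D then (0 : ℝ) else
        (subsetSum (fun _ => 1) (insert i D) - subsetSum (fun _ => 1) D) *
          (subsetSum (fun _ => 1) Dᶜ - subsetSum (fun _ => 1) (Dᶜ.erase i))) =
      4 ^ Fintype.card α / 4 := by
    intro i
    have h3 : (∑ D : Finset α, (2 : ℝ) ^ Fintype.card α / 4) = 4 ^ Fintype.card α / 4 := by
      rw [Finset.sum_const, Finset.card_univ, Fintype.card_finset, nsmul_eq_mul]
      push_cast
      rw [mul_div_assoc', ← mul_pow]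
      norm_num
    rw [← h3, ← sum_ite_mem_add i fun _ => (2 : ℝ) ^ Fintype.card α / 4]
    refine Finset.sum_congr rfl fun D _ => ?_
    split_ifs with hi
    · rfl
    · have hc : (Dᶜ.erase i).card + 1 = Dᶜ.card :=
        Finset.card_erase_add_one (Finset.mem_compl.2 hi)
      have hc2 := Finset.card_add_card_compl D
      rw [hs, hs, hs, hs, Finset.card_insert_of_notMem hi, ← hc2, ← hc]
      ring
  simp_rw [h2]
  rw [Finset.sum_const, Finset.card_univ, nsmul_eq_mul]
  have : (Fintype.card α : ℝ) ≠ 0 := by exact_mod_cast Fintype.card_ne_zero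
  have h4 : (1 / 4 : ℝ) ^ Fintype.card α * 4 ^ Fintype.card α = 1 := by rw [← mul_pow]; norm_num
  field_simp
  linarith

theorem disjointWeight_nonneg (x y : Finset α) : 0 ≤ disjointWeight x y := by
  unfold disjointWeight pairWeight
  positivity

theorem uniqueWeight_nonneg (x y : Finset α) : 0 ≤ uniqueWeight x y := by
  unfold uniqueWeight pairWeight
  positivity

end Corruption

/-! ### Local views in the message-passing model -/

namespace Protocol

variable {k : ℕ} {X : Type}

theorem transcript_succ_of_none (P : Protocol k X) {x : Fin k → X} {s : ℕ}
    (h : P.next (P.transcript x s) = none) : P.transcript x (s + 1) = P.transcript x s := by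
  simp [transcript, h]

theorem transcript_succ_of_some (P : Protocol k X) {x : Fin k → X} {s : ℕ} {i j : Fin k}
    (h : P.next (P.transcript x s) = some (i, j)) :
    P.transcript x (s + 1) = P.transcript x s ++
      [⟨i, j, P.message i (x i) (localView i (P.transcript x s)) j⟩] := by
  simp [transcript, h]

theorem transcript_eq_of_none (P : Protocol k X) {x : Fin k → X} {s t : ℕ} (hst : s ≤ t)
    (h : P.next (P.transcript x s) = none) : P.transcript x t = P.transcript x s := by
  induction t, hst using Nat.le_induction with
  | base => rfl
  | succ t _ ih => rw [P.transcript_succ_of_none (ih ▸ h), ih]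

theorem transcript_prefix (P : Protocol k X) (x : Fin k → X) {s t : ℕ} (hst : s ≤ t) :
    P.transcript x s <+: P.transcript x t := by
  induction t, hst using Nat.le_induction with
  | base => exact List.prefix_rfl
  | succ t _ ih =>
    refine ih.trans ?_
    rcases h : P.next (P.transcript x t) with _ | ⟨i, j⟩
    · rw [P.transcript_succ_of_none h]
    · rw [P.transcript_succ_of_some h]
      exact List.prefix_append _ _

theorem length_transcript_le_of_cost_le (P : Protocol k X) {x : Fin k → X} {C : ℕ}
    (h : P.cost x ≤ C) (s : ℕ) : (P.transcript x s).length ≤ C := by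
  have := (le_iSup (fun s => ((P.transcript x s).length : ℕ∞)) s).trans h
  exact_mod_cast this

theorem length_transcript_or_next_eq_none (P : Protocol k X) (x : Fin k → X) (s : ℕ) :
    (P.transcript x s).length = s ∨ P.next (P.transcript x s) = none := by
  induction s with
  | zero => exact Or.inl rfl
  | succ s ih =>
    rcases h : P.next (P.transcript x s) with _ | ⟨i, j⟩
    · exact Or.inr (by rw [P.transcript_succ_of_none h, h])
    · rcases ih with ih | ih
      · exact Or.inl (by rw [P.transcript_succ_of_some h]; simp [ih])
      · simp [ih] at h

/-- The transcript of a protocol of cost at most `C` is final after `C` steps. -/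
theorem transcript_eq_of_cost_le (P : Protocol k X) {x : Fin k → X} {C : ℕ}
    (h : P.cost x ≤ C) {s : ℕ} (hs : P.next (P.transcript x s) = none) :
    P.transcript x C = P.transcript x s := by
  rcases le_total s C with hsC | hsC
  · exact P.transcript_eq_of_none hsC hs
  · have hC : P.next (P.transcript x C) = none := by
      rcases hn : P.next (P.transcript x C) with _ | ⟨i, j⟩
      · rfl
      · have h1 := P.length_transcript_le_of_cost_le h (C + 1)
        rcases P.length_transcript_or_next_eq_none x C with h2 | h2
        · rw [P.transcript_succ_of_some hn] at h1
          simp [h2] at h1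
        · simp [h2] at hn
    exact (P.transcript_eq_of_none hsC hC).symm

theorem localView_append (i : Fin k) (t u : Transcript k) :
    localView i (t ++ u) = localView i t ++ localView i u :=
  List.filter_append ..

theorem localView_prefix (i : Fin k) {t u : Transcript k} (h : t <+: u) :
    localView i t <+: localView i u :=
  h.filter _

theorem localView_singleton_sender (i j : Fin k) (b : Bool) :
    localView i [⟨i, j, b⟩] = [⟨i, j, b⟩] := by
  simp [localView]

/-- The bits that site `i` sends are determined by its input and its preceding view. -/
theorem bit_eq_message (P : Protocol k X) (x : Fin k → X) (i : Fin k) (s : ℕ)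
    {p : List (Message k)} {m : Message k} (hm : m.sender = i)
    (hp : p ++ [m] <+: localView i (P.transcript x s)) :
    m.bit = P.message i (x i) p m.receiver := by
  induction s with
  | zero => simp [transcript, localView] at hp
  | succ s ih =>
    rcases h : P.next (P.transcript x s) with _ | ⟨a, j⟩
    · rw [P.transcript_succ_of_none h] at hp
      exact ih hp
    · rw [P.transcript_succ_of_some h, localView_append] at hp
      set m' : Message k := ⟨a, j, P.message a (x a) (localView a (P.transcript x s)) j⟩
      by_cases hv : m'.sender = i ∨ m'.receiver = i
      · have hl : localView i [m'] = [m'] := by simp [localView, hv]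
        rw [hl, List.prefix_concat_iff] at hp
        rcases hp with hp | hp
        · obtain ⟨h1, h2⟩ := List.append_inj' hp rfl
          obtain rfl : m = m' := by simpa using h2
          obtain rfl : a = i := hm
          rw [h1]
        · exact ih hp
      · have hl : localView i [m'] = [] := by simp [localView, hv]
        rw [hl, List.append_nil] at hp
        exact ih hp

/-- The cut-and-paste property: two inputs with the same view of site `i` can be exchanged at
site `i` without changing the transcript. -/
theorem transcript_update (P : Protocol k X) {u v : Fin k → X} {i : Fin k} {C : ℕ}
    (h : localView i (P.transcript u C) = localView i (P.transcript v C)) {s : ℕ} (hs : s ≤ C) :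
    P.transcript (Function.update v i (u i)) s = P.transcript v s := by
  induction s with
  | zero => rfl
  | succ s ih =>
    have ih := ih (by omega)
    rcases hn : P.next (P.transcript v s) with _ | ⟨a, j⟩
    · rw [P.transcript_succ_of_none hn, P.transcript_succ_of_none (by rw [ih, hn]), ih]
    · rw [P.transcript_succ_of_some hn, P.transcript_succ_of_some (by rw [ih, hn]), ih]
      congr 3
      by_cases ha : a = i
      · subst ha
        rw [Function.update_self]
        have hp := localView_prefix a (P.transcript_prefix v hs)
        rw [P.transcript_succ_of_some hn, localView_append, localView_singleton_sender, ← h] at hp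
        exact (P.bit_eq_message u a C rfl hp).symm
      · rw [Function.update_of_ne ha]

/-- Each message is seen only by its sender and its receiver. -/
theorem sum_length_localView_le (t : Transcript k) :
    ∑ i, (localView i t).length ≤ 2 * t.length := by
  induction t with
  | nil => simp [localView]
  | cons m t ih =>
    have h : ∀ i : Fin k, (localView i (m :: t)).length ≤
        ((if m.sender = i then 1 else 0) + if m.receiver = i then 1 else 0) +
          (localView i t).length := by
      intro i
      by_cases h1 : m.sender = i <;> by_cases h2 : m.receiver = i <;>
        simp [localView, h1, h2, add_comm]
    refine (Finset.sum_le_sum fun i _ => h i).trans ?_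
    rw [Finset.sum_add_distrib, Finset.sum_add_distrib]
    simp only [Finset.sum_ite_eq, Finset.mem_univ, if_true, List.length_cons]
    omega

end Protocol

/-- Messages as triples. -/
def messageEquiv (k : ℕ) : Message k ≃ Fin k × Fin k × Bool where
  toFun m := (m.sender, m.receiver, m.bit)
  invFun p := ⟨p.1, p.2.1, p.2.2⟩
  left_inv _ := rfl
  right_inv _ := rfl

/-- A finite set that contains all lists of at most `L` messages. -/
theorem exists_finset_views (k L : ℕ) : ∃ N : Finset (List (Message k)),
    (∀ l, l ∈ N ↔ l.length ≤ L) ∧ N.card ≤ (2 * k ^ 2 + 1) ^ L := by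
  let _ : Fintype (Message k) := Fintype.ofEquiv _ (messageEquiv k).symm
  have hfin : {l : List (Message k) | l.length ≤ L}.Finite := List.finite_length_le _ L
  refine ⟨hfin.toFinset, by simp, ?_⟩
  have hcard : Fintype.card (Fin L → Option (Message k)) = (2 * k ^ 2 + 1) ^ L := by
    rw [Fintype.card_fun, Fintype.card_option, Fintype.card_congr (messageEquiv k)]
    simp
    ring_nf
  rw [← hcard, ← Finset.card_univ]
  -- A list of length at most L is encoded by L optional entries, `none` marking positions past its
  -- end; hence the base 2k² + 1.
  refine Finset.card_le_card_of_injOn (fun l j => l[(j : ℕ)]?) (fun _ _ => Finset.mem_univ _) ?_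
  intro l hl l' hl' h
  simp only [Set.Finite.coe_toFinset, Set.mem_ofPred_eq] at hl hl'
  refine List.ext_getElem? fun j => ?_
  by_cases hj : j < L
  · exact congrFun h ⟨j, hj⟩
  · rw [List.getElem?_eq_none (by omega), List.getElem?_eq_none (by omega)]

namespace Protocol

variable {k : ℕ} {X : Type}

/-- The answer that is reported after `C` steps on input `x`. -/
def answerAt (P : Protocol k X) (C : ℕ) (x : Fin k → X) : Bool :=
  P.answer (P.reporter (P.transcript x C)) (x (P.reporter (P.transcript x C)))
    (localView (P.reporter (P.transcript x C)) (P.transcript x C))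

theorem answerAt_of_correct (P : Protocol k X) {f : (Fin k → X) → Prop} {x : Fin k → X} {C : ℕ}
    (hC : P.cost x ≤ C) (h : P.Correct f x) : P.answerAt C x = true ↔ f x := by
  obtain ⟨s, hs, ha⟩ := h
  rw [answerAt, P.transcript_eq_of_cost_le hC hs]
  exact ha

/-- A set of inputs with a fixed view of site `i` and a fixed answer is a rectangle with respect to
the input of site `i` and the inputs of the other sites, once it is known whether site `i`
reports. -/
theorem answerAt_update (P : Protocol k X) {u v : Fin k → X} {i : Fin k} {C : ℕ}
    (h : localView i (P.transcript u C) = localView i (P.transcript v C))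
    (hr : P.reporter (P.transcript u C) = i ↔ P.reporter (P.transcript v C) = i)
    (ha : P.answerAt C u = P.answerAt C v) :
    P.answerAt C (Function.update v i (u i)) = P.answerAt C v := by
  rw [answerAt, P.transcript_update h le_rfl]
  -- If site i reports, its answer uses the swapped input together with the common view, so it is
  -- the answer on `u`; otherwise the reporter's input is untouched.
  by_cases hv : P.reporter (P.transcript v C) = i
  · have hu := hr.2 hv
    rw [← ha, answerAt, hu, hv, Function.update_self, h]
  · rw [Function.update_of_ne hv, answerAt]

end Protocol

/-! ### Resampling -/

section Resampling

variable {ι β : Type*} [Fintype ι] [DecidableEq ι]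

theorem prod_update_mul (q : β → ℝ) (x : ι → β) (i : ι) (a : β) :
    (∏ j, q (Function.update x i a j)) * q (x i) = (∏ j, q (x j)) * q a := by
  rw [← Finset.mul_prod_erase _ _ (Finset.mem_univ i),
    ← Finset.mul_prod_erase _ (fun j => q (x j)) (Finset.mem_univ i), Function.update_self]
  have : ∏ j ∈ Finset.univ.erase i, q (Function.update x i a j) =
      ∏ j ∈ Finset.univ.erase i, q (x j) :=
    Finset.prod_congr rfl fun j hj => by rw [Function.update_of_ne (Finset.ne_of_mem_erase hj)]
  rw [this]
  ring

variable [Fintype β]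

theorem sum_prod_eq_one {q : β → ℝ} (hq : ∑ b, q b = 1) : ∑ x : ι → β, ∏ j, q (x j) = 1 := by
  classical
  have := Finset.prod_univ_sum (fun _ : ι => (Finset.univ : Finset β)) (fun _ b => q b)
  simp only [hq, Finset.prod_const_one, Fintype.piFinset_univ] at this
  exact this.symm

/-- Resampling one coordinate does not change a product distribution. -/
theorem sum_prod_mul_resample {q : β → ℝ} (hq : ∑ b, q b = 1) (i : ι) (h : (ι → β) → ℝ) :
    ∑ x : ι → β, (∏ j, q (x j)) * ∑ a, q a * h (Function.update x i a) =
      ∑ x : ι → β, (∏ j, q (x j)) * h x := by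
  -- Exchanging coordinate i with the fresh sample preserves the joint weight (`prod_update_mul`).
  let e : Equiv.Perm ((ι → β) × β) := Function.Involutive.toPerm
    (fun p => (Function.update p.1 i p.2, p.1 i)) fun p => by simp
  have h1 : ∑ p : (ι → β) × β, (∏ j, q (p.1 j)) * q p.2 * h (Function.update p.1 i p.2) =
      ∑ p : (ι → β) × β, (∏ j, q (p.1 j)) * q p.2 * h p.1 := by
    rw [← Equiv.sum_comp e]
    refine Finset.sum_congr rfl fun p _ => ?_
    have : e p = (Function.update p.1 i p.2, p.1 i) := rfl
    rw [this]
    dsimp only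
    rw [prod_update_mul, Function.update_idem, Function.update_eq_self]
  rw [Fintype.sum_prod_type, Fintype.sum_prod_type] at h1
  simp_rw [Finset.mul_sum, ← mul_assoc]
  rw [h1]
  refine Finset.sum_congr rfl fun x _ => ?_
  dsimp only
  rw [← Finset.sum_mul, ← Finset.mul_sum, hq, mul_one]

end Resampling

/-! ### The hard input distributions -/

open Classical in
/-- The indicator of a proposition. -/
noncomputable def indicatorOf (p : Prop) : ℝ := if p then 1 else 0

theorem indicatorOf_nonneg (p : Prop) : 0 ≤ indicatorOf p := by
  unfold indicatorOf; split_ifs <;> norm_num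

theorem indicatorOf_le_one (p : Prop) : indicatorOf p ≤ 1 := by
  unfold indicatorOf; split_ifs <;> norm_num

theorem indicatorOf_mono {p q : Prop} (h : p → q) : indicatorOf p ≤ indicatorOf q := by
  unfold indicatorOf; split_ifs <;> simp_all

section HardDistribution

variable {α ι : Type*} [DecidableEq α] [Fintype α] [Fintype ι]

/-- The marginal distribution of the second set under `disjointWeight`. -/
noncomputable def marginalWeight (y : Finset α) : ℝ := ∑ a, disjointWeight a y

/-- The conditional distribution of the first set under `disjointWeight`. -/
noncomputable def conditionalWeight (y a : Finset α) : ℝ := disjointWeight a y / marginalWeight y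

/-- The probability, given `y`, of independent samples of the first set. -/
noncomputable def sampleWeight (y : Finset α) (x : ι → Finset α) : ℝ :=
  ∏ j, conditionalWeight y (x j)

theorem marginalWeight_pos (y : Finset α) : 0 < marginalWeight y := by
  refine lt_of_lt_of_le ?_ (Finset.single_le_sum (fun a _ => disjointWeight_nonneg a y)
    (Finset.mem_univ ∅))
  rw [disjointWeight, if_pos (Finset.disjoint_empty_left y), pairWeight]
  positivity

theorem conditionalWeight_nonneg (y a : Finset α) : 0 ≤ conditionalWeight y a :=
  div_nonneg (disjointWeight_nonneg a y) (marginalWeight_pos y).le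

theorem sum_conditionalWeight (y : Finset α) : ∑ a, conditionalWeight y a = 1 := by
  unfold conditionalWeight
  rw [← Finset.sum_div]
  exact div_self (marginalWeight_pos y).ne'

theorem sampleWeight_nonneg (y : Finset α) (x : ι → Finset α) : 0 ≤ sampleWeight y x :=
  Finset.prod_nonneg fun _ _ => conditionalWeight_nonneg _ _

theorem sampleWeight_eq_zero {y : Finset α} {x : ι → Finset α} {j : ι}
    (h : ¬ Disjoint (x j) y) : sampleWeight y x = 0 :=
  Finset.prod_eq_zero (Finset.mem_univ j) (by rw [conditionalWeight, disjointWeight, if_neg h,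
    zero_div])

variable [DecidableEq ι]

theorem sum_sampleWeight (y : Finset α) : ∑ x : ι → Finset α, sampleWeight y x = 1 :=
  sum_prod_eq_one (sum_conditionalWeight y)

/-- The expectation of `h` when `y` and the independent samples `x` are pairwise disjoint. -/
noncomputable def disjointMean (h : Finset α → (ι → Finset α) → ℝ) : ℝ :=
  ∑ y, ∑ x, marginalWeight y * sampleWeight y x * h y x

/-- The expectation of `h` when the sample of site `i` is replaced according to the joint
weight `w`. -/
noncomputable def replacedMean (w : Finset α → Finset α → ℝ) (i : ι)
    (h : Finset α → (ι → Finset α) → ℝ) : ℝ :=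
  ∑ y, ∑ x, sampleWeight y x * ∑ a, w a y * h y (Function.update x i a)

/-- Under `disjointWeight` the replacement is a fresh draw from the same conditional law given y, so
nothing changes. -/
theorem replacedMean_disjointWeight (i : ι) (h : Finset α → (ι → Finset α) → ℝ) :
    replacedMean disjointWeight i h = disjointMean h := by
  unfold replacedMean disjointMean
  refine Finset.sum_congr rfl fun y _ => ?_
  have h1 := sum_prod_mul_resample (sum_conditionalWeight y) i (h y)
  have h2 : ∀ a, disjointWeight a y = marginalWeight y * conditionalWeight y a := fun a => by
    rw [conditionalWeight, mul_div_cancel₀ _ (marginalWeight_pos y).ne']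
  simp_rw [h2, mul_assoc]
  rw [← Finset.mul_sum]
  unfold sampleWeight
  rw [← h1, Finset.mul_sum]
  refine Finset.sum_congr rfl fun x _ => ?_
  rw [← Finset.mul_sum]
  ring

theorem disjointMean_mono {h h' : Finset α → (ι → Finset α) → ℝ}
    (hh : ∀ y x, (∀ j, Disjoint (x j) y) → h y x ≤ h' y x) : disjointMean h ≤ disjointMean h' := by
  refine Finset.sum_le_sum fun y _ => Finset.sum_le_sum fun x _ => ?_
  by_cases hd : ∀ j, Disjoint (x j) y
  · exact mul_le_mul_of_nonneg_left (hh y x hd)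
      (mul_nonneg (marginalWeight_pos y).le (sampleWeight_nonneg y x))
  · push Not at hd
    obtain ⟨j, hj⟩ := hd
    simp [sampleWeight_eq_zero hj]

theorem disjointMean_const (c : ℝ) :
    disjointMean (fun (_ : Finset α) (_ : ι → Finset α) => c) = c := by
  unfold disjointMean
  simp_rw [← Finset.sum_mul, ← Finset.mul_sum, sum_sampleWeight, mul_one]
  have := sum_disjointWeight_eq_one (α := α)
  rw [Finset.sum_comm] at this
  unfold marginalWeight
  rw [this, one_mul]

theorem disjointMean_sum {κ : Type*} (s : Finset κ) (h : κ → Finset α → (ι → Finset α) → ℝ) :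
    disjointMean (fun y x => ∑ l ∈ s, h l y x) = ∑ l ∈ s, disjointMean (h l) := by
  unfold disjointMean
  simp_rw [Finset.mul_sum]
  exact (Finset.sum_congr rfl fun y _ => Finset.sum_comm).trans Finset.sum_comm

theorem disjointMean_add (h h' : Finset α → (ι → Finset α) → ℝ) :
    disjointMean (fun y x => h y x + h' y x) = disjointMean h + disjointMean h' := by
  unfold disjointMean
  simp_rw [mul_add, Finset.sum_add_distrib]

theorem replacedMean_sum {κ : Type*} (s : Finset κ) (w : Finset α → Finset α → ℝ) (i : ι)
    (h : κ → Finset α → (ι → Finset α) → ℝ) :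
    replacedMean w i (fun y x => ∑ l ∈ s, h l y x) = ∑ l ∈ s, replacedMean w i (h l) := by
  unfold replacedMean
  simp_rw [Finset.mul_sum]
  refine (Finset.sum_congr rfl fun y _ => ?_).trans Finset.sum_comm
  exact (Finset.sum_congr rfl fun x _ => Finset.sum_comm).trans Finset.sum_comm

theorem replacedMean_uniqueWeight_mono (i : ι) {h h' : Finset α → (ι → Finset α) → ℝ}
    (hh : ∀ y x, ((x i) ∩ y).card = 1 → h y x ≤ h' y x) :
    replacedMean uniqueWeight i h ≤ replacedMean uniqueWeight i h' := by
  refine Finset.sum_le_sum fun y _ => Finset.sum_le_sum fun x _ =>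
    mul_le_mul_of_nonneg_left (Finset.sum_le_sum fun a _ => ?_) (sampleWeight_nonneg y x)
  by_cases ha : (a ∩ y).card = 1
  · exact mul_le_mul_of_nonneg_left (hh y _ (by rwa [Function.update_self]))
      (uniqueWeight_nonneg a y)
  · rw [uniqueWeight, if_neg ha, zero_mul, zero_mul]

/-- Given y, the replaced set is independent of the samples, so g may be averaged over them; this
leaves a two-party product in a and y. -/
theorem replacedMean_rectangle (w : Finset α → Finset α → ℝ) (i : ι)
    {h : Finset α → (ι → Finset α) → ℝ} {f : Finset α → ℝ} {g : Finset α → (ι → Finset α) → ℝ}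
    (hfg : ∀ y x a, h y (Function.update x i a) = f a * g y x) :
    replacedMean w i h = ∑ a, ∑ y, w a y * (f a * ∑ x, sampleWeight y x * g y x) := by
  rw [Finset.sum_comm]
  refine Finset.sum_congr rfl fun y _ => ?_
  simp_rw [hfg, Finset.mul_sum]
  rw [Finset.sum_comm]
  refine Finset.sum_congr rfl fun a _ => Finset.sum_congr rfl fun x _ => ?_
  ring

/-- The corruption bound for a rectangle of inputs with respect to one site. -/
theorem replacedMean_ge_of_rectangle (h100 : 100 ≤ Fintype.card α) (i : ι)
    {R : Finset α → (ι → Finset α) → Prop}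
    (hR : ∀ y x a y' x' a', R y (Function.update x i a) → R y' (Function.update x' i a') →
      R y' (Function.update x' i a)) :
    9 / 10 * disjointMean (fun y x => indicatorOf (R y x)) -
        Real.exp (-(Fintype.card α / 2000 : ℝ)) ≤
      replacedMean uniqueWeight i (fun y x => indicatorOf (R y x)) := by
  -- `f` and `g` indicate the two projections of the rectangle `R`; closure under exchange makes `R`
  -- their product.
  set f : Finset α → ℝ := fun a => indicatorOf (∃ y x, R y (Function.update x i a))
  set g : Finset α → (ι → Finset α) → ℝ := fun y x =>
    indicatorOf (∃ a, R y (Function.update x i a))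
  have hfg : ∀ y x a, indicatorOf (R y (Function.update x i a)) = f a * g y x := by
    intro y x a
    by_cases h : R y (Function.update x i a)
    · have h1 : ∃ y x, R y (Function.update x i a) := ⟨y, x, h⟩
      have h2 : ∃ a, R y (Function.update x i a) := ⟨a, h⟩
      simp [f, g, indicatorOf, h, h1, h2]
    · by_cases h1 : ∃ y x, R y (Function.update x i a)
      · by_cases h2 : ∃ a, R y (Function.update x i a)
        · obtain ⟨y', x', h1⟩ := h1
          obtain ⟨a', h2⟩ := h2
          exact absurd (hR _ _ _ _ _ _ h1 h2) h
        · simp only [f, g, indicatorOf, h, h2, if_false, mul_zero]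
      · simp only [f, g, indicatorOf, h, h1, if_false, zero_mul]
  rw [← replacedMean_disjointWeight i, replacedMean_rectangle _ i hfg,
    replacedMean_rectangle _ i hfg]
  refine corruption_bound h100 (fun _ => indicatorOf_nonneg _) (fun _ => indicatorOf_le_one _)
    (fun y => Finset.sum_nonneg fun x _ => mul_nonneg (sampleWeight_nonneg y x)
      (indicatorOf_nonneg _)) fun y => ?_
  rw [← sum_sampleWeight (ι := ι) y]
  exact Finset.sum_le_sum fun x _ =>
    mul_le_of_le_one_right (sampleWeight_nonneg y x) (indicatorOf_le_one _)

end HardDistribution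

/-! ### The graphs that encode set disjointness -/

/-- The graph of a site with the set `x`: the vertex `0` is adjacent to the vertices `2 + j` with
`j ∈ x`. -/
def aliceGraph (n : ℕ) {r : ℕ} (x : Finset (Fin r)) : SimpleGraph (Fin n) :=
  SimpleGraph.fromRel fun a b => a.val = 0 ∧ ∃ j ∈ x, b.val = 2 + j.val

/-- The graph of the site with the set `y`: the vertex `1` is adjacent to `0` and to the vertices
`2 + j` with `j ∈ y`, and the vertices `r + 2` and `r + 3` are adjacent to all later ones. -/
def bobGraph (n : ℕ) {r : ℕ} (y : Finset (Fin r)) : SimpleGraph (Fin n) :=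
  SimpleGraph.fromRel fun a b => a.val = 1 ∧ (b.val = 0 ∨ ∃ j ∈ y, b.val = 2 + j.val) ∨
    (a.val = r + 2 ∨ a.val = r + 3) ∧ r + 4 ≤ b.val

/-- The input in which site `0` holds `y` and site `i + 1` holds `x i`. -/
def hardInput {X V : Type*} {m : ℕ} (bob alice : V → X) (y : V) (x : Fin m → V) :
    Fin (m + 1) → X :=
  Fin.cons (bob y) fun i => alice (x i)

section Graphs

variable {n r m : ℕ} {y : Finset (Fin r)} {x : Fin m → Finset (Fin r)}

theorem unionGraph_hardInput_adj (a b : Fin n) :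
    (unionGraph (hardInput (bobGraph n) (aliceGraph n) y x)).Adj a b ↔
      (bobGraph n y).Adj a b ∨ ∃ i, (aliceGraph n (x i)).Adj a b := by
  simp [unionGraph, hardInput, SimpleGraph.iSup_adj, Fin.exists_fin_succ]

/-- The two hubs r + 2 and r + 3 alone supply 2(n - r - 4) edges, which is at least n because r ≤
n/4 and n ≥ 16. -/
theorem hardInput_mem_graphInputs (hn : 16 ≤ n) (hr : 4 * r ≤ n) :
    hardInput (bobGraph n) (aliceGraph n) y x ∈ graphInputs (m + 1) n := by
  have h0 : r + 4 < n := by omega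
  let hub : ℕ → Finset (Sym2 (Fin n)) := fun c =>
    (Finset.Ici (⟨r + 4, h0⟩ : Fin n)).image fun q => s(⟨(r + c) % n, Nat.mod_lt _ (by omega)⟩, q)
  have hval : ∀ c, c < 4 → (r + c) % n = r + c := fun c hc => Nat.mod_eq_of_lt (by omega)
  have hcard : ∀ c, c < 4 → (hub c).card = n - (r + 4) := by
    intro c hc
    rw [Finset.card_image_of_injOn, Fin.card_Ici]
    intro p hp q hq h
    simp only [Finset.coe_Ici, Set.mem_Ici, Fin.le_def] at hp hq
    simp only [Sym2.eq_iff, Fin.ext_iff, hval c hc] at h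
    exact Fin.ext (by omega)
  have hdisj : Disjoint (hub 2) (hub 3) := by
    rw [Finset.disjoint_left]
    intro e he he'
    obtain ⟨p, hp, rfl⟩ := Finset.mem_image.1 he
    obtain ⟨q, hq, h⟩ := Finset.mem_image.1 he'
    simp only [Finset.mem_Ici, Fin.le_def] at hp hq
    simp only [Sym2.eq_iff, Fin.ext_iff, hval 2 (by norm_num), hval 3 (by norm_num)] at h
    omega
  have hsub : ((hub 2 ∪ hub 3 : Finset _) : Set (Sym2 (Fin n))) ⊆
      (unionGraph (hardInput (bobGraph n) (aliceGraph n) y x)).edgeSet := by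
    intro e he
    have : ∃ c, (c = 2 ∨ c = 3) ∧ e ∈ hub c := by
      rcases Finset.mem_union.1 (Finset.mem_coe.1 he) with h | h
      · exact ⟨2, Or.inl rfl, h⟩
      · exact ⟨3, Or.inr rfl, h⟩
    obtain ⟨c, hc, h⟩ := this
    obtain ⟨q, hq, rfl⟩ := Finset.mem_image.1 h
    have hv := hval c (by omega)
    simp only [Finset.mem_Ici, Fin.le_def] at hq
    rw [SimpleGraph.mem_edgeSet, unionGraph_hardInput_adj]
    refine Or.inl ?_
    rw [bobGraph, SimpleGraph.fromRel_adj]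
    refine ⟨fun h => ?_, Or.inl (Or.inr ⟨?_, hq⟩)⟩
    · rw [Fin.ext_iff] at h
      simp only [hv] at h
      omega
    · simp only [hv]
      omega
  have := Set.ncard_le_ncard hsub (Set.toFinite _)
  rw [Set.ncard_coe_finset, Finset.card_union_of_disjoint hdisj, hcard 2 (by norm_num),
    hcard 3 (by norm_num)] at this
  change n ≤ _
  omega

theorem bipartiteness_of_disjoint (h : ∀ i, Disjoint (x i) y) :
    Bipartiteness (m + 1) n (hardInput (bobGraph n) (aliceGraph n) y x) := by
  classical
  -- Class 0 consists of vertex 0, the two hubs and the vertices of y. Disjointness puts the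
  -- neighbours of 0 coming from the x i into class 1, next to vertex 1.
  let color : Fin n → Fin 2 := fun v =>
    if v.val = 0 ∨ v.val = r + 2 ∨ v.val = r + 3 ∨ ∃ j ∈ y, v.val = 2 + j.val then 0 else 1
  have h0 : ∀ v : Fin n, v.val = 0 → color v = 0 := fun v hv => if_pos (Or.inl hv)
  have hj : ∀ (v : Fin n) (j : Fin r), v.val = 2 + j.val → j ∉ y → color v = 1 := by
    intro v j hv hjy
    refine if_neg ?_
    have := j.isLt
    rintro (h | h | h | ⟨j', hj', h⟩)
    · omega
    · omega
    · omega
    · exact hjy ((Fin.ext (by omega : j.val = j'.val)) ▸ hj')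
  have hrel : ∀ a b : Fin n, (a.val = 1 ∧ (b.val = 0 ∨ ∃ j ∈ y, b.val = 2 + j.val) ∨
      (a.val = r + 2 ∨ a.val = r + 3) ∧ r + 4 ≤ b.val) → color a ≠ color b := by
    rintro a b (⟨ha, hb⟩ | ⟨ha, hb⟩)
    · have h1 : color a = 1 := if_neg (by
        rintro (h | h | h | ⟨j', hj', h⟩) <;> omega)
      have h2 : color b = 0 := if_pos (by tauto)
      simp [h1, h2]
    · have h1 : color a = 0 := if_pos (by tauto)
      have h2 : color b = 1 := if_neg (by
        rintro (h | h | h | ⟨j', hj', h⟩)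
        · omega
        · omega
        · omega
        · have := j'.isLt
          omega)
      simp [h1, h2]
  have hrel' : ∀ i, ∀ a b : Fin n, (a.val = 0 ∧ ∃ j ∈ x i, b.val = 2 + j.val) →
      color a ≠ color b := by
    rintro i a b ⟨ha, j, hjx, hb⟩
    simp [h0 a ha, hj b j hb (Finset.disjoint_left.1 (h i) hjx)]
  refine ⟨SimpleGraph.Coloring.mk color fun {a b} hab => ?_⟩
  rw [unionGraph_hardInput_adj] at hab
  rcases hab with hab | ⟨i, hab⟩
  · rw [bobGraph, SimpleGraph.fromRel_adj] at hab
    exact hab.2.elim (hrel a b) fun h => (hrel b a h).symm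
  · rw [aliceGraph, SimpleGraph.fromRel_adj] at hab
    exact hab.2.elim (hrel' i a b) fun h => (hrel' i b a h).symm

/-- The vertices 0, 1 and 2 + j form a triangle, which two colours cannot colour properly. -/
theorem not_bipartiteness_of_mem (hr : r + 2 ≤ n) {i : Fin m} {j : Fin r} (hx : j ∈ x i)
    (hy : j ∈ y) : ¬ Bipartiteness (m + 1) n (hardInput (bobGraph n) (aliceGraph n) y x) := by
  rintro ⟨color⟩
  have hj := j.isLt
  let u : Fin n := ⟨0, by omega⟩
  let w : Fin n := ⟨1, by omega⟩
  let v : Fin n := ⟨2 + j.val, by omega⟩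
  have h1 : color w ≠ color u := color.valid (by
    rw [unionGraph_hardInput_adj, bobGraph, SimpleGraph.fromRel_adj]
    exact Or.inl ⟨by simp [u, w, Fin.ext_iff], Or.inl (Or.inl ⟨rfl, Or.inl rfl⟩)⟩)
  have h2 : color w ≠ color v := color.valid (by
    rw [unionGraph_hardInput_adj, bobGraph, SimpleGraph.fromRel_adj]
    exact Or.inl ⟨by simp [v, w, Fin.ext_iff]; omega, Or.inl (Or.inl ⟨rfl, Or.inr ⟨j, hy, rfl⟩⟩)⟩)
  have h3 : color u ≠ color v := color.valid (by
    rw [unionGraph_hardInput_adj]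
    refine Or.inr ⟨i, ?_⟩
    rw [aliceGraph, SimpleGraph.fromRel_adj]
    exact ⟨by simp [u, v, Fin.ext_iff]; omega, Or.inl ⟨rfl, j, hx, rfl⟩⟩)
  rw [Ne, Fin.ext_iff] at h1 h2 h3
  omega

end Graphs

open MeasureTheory

/-! ### The error of cheap protocols -/

section Means

variable {α ι : Type*} [DecidableEq α] [Fintype α] [Fintype ι] [DecidableEq ι]

theorem replacedMean_uniqueWeight_const [Nonempty α] (i : ι) (c : ℝ) :
    replacedMean uniqueWeight i (fun (_ : Finset α) (_ : ι → Finset α) => c) = c := by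
  unfold replacedMean
  simp_rw [← Finset.sum_mul, sum_sampleWeight, one_mul, ← Finset.sum_mul]
  have := sum_uniqueWeight_eq_one (α := α)
  rw [Finset.sum_comm] at this
  rw [this, one_mul]

variable {Ω : Type*} [MeasurableSpace Ω] {μ : Measure Ω}
  {h : Ω → Finset α → (ι → Finset α) → ℝ}

theorem integrable_disjointMean (hh : ∀ y x, Integrable (fun ω => h ω y x) μ) :
    Integrable (fun ω => disjointMean (h ω)) μ :=
  integrable_finsetSum _ fun y _ => integrable_finsetSum _ fun x _ => (hh y x).const_mul _

theorem integral_disjointMean (hh : ∀ y x, Integrable (fun ω => h ω y x) μ) :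
    ∫ ω, disjointMean (h ω) ∂μ = disjointMean fun y x => ∫ ω, h ω y x ∂μ := by
  unfold disjointMean
  rw [integral_finsetSum _ fun y _ => integrable_finsetSum _ fun x _ => (hh y x).const_mul _]
  refine Finset.sum_congr rfl fun y _ => ?_
  rw [integral_finsetSum _ fun x _ => (hh y x).const_mul _]
  exact Finset.sum_congr rfl fun x _ => integral_const_mul _ _

theorem integrable_replacedMean (w : Finset α → Finset α → ℝ) (i : ι)
    (hh : ∀ y x, Integrable (fun ω => h ω y x) μ) :
    Integrable (fun ω => replacedMean w i (h ω)) μ :=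
  integrable_finsetSum _ fun _ _ => integrable_finsetSum _ fun _ _ =>
    (integrable_finsetSum _ fun _ _ => (hh _ _).const_mul _).const_mul _

theorem integral_replacedMean (w : Finset α → Finset α → ℝ) (i : ι)
    (hh : ∀ y x, Integrable (fun ω => h ω y x) μ) :
    ∫ ω, replacedMean w i (h ω) ∂μ = replacedMean w i fun y x => ∫ ω, h ω y x ∂μ := by
  unfold replacedMean
  rw [integral_finsetSum _ fun _ _ => integrable_finsetSum _ fun _ _ =>
    (integrable_finsetSum _ fun _ _ => (hh _ _).const_mul _).const_mul _]
  refine Finset.sum_congr rfl fun y _ => ?_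
  rw [integral_finsetSum _ fun _ _ =>
    (integrable_finsetSum _ fun _ _ => (hh _ _).const_mul _).const_mul _]
  refine Finset.sum_congr rfl fun x _ => ?_
  rw [integral_const_mul, integral_finsetSum _ fun _ _ => (hh _ _).const_mul _]
  exact congrArg _ (Finset.sum_congr rfl fun a _ => integral_const_mul _ _)

end Means

theorem hardInput_update {X V : Type*} {m : ℕ} (bob alice : V → X) (y : V) (x : Fin m → V)
    (i : Fin m) (a : V) :
    hardInput bob alice y (Function.update x i a) =
      Function.update (hardInput bob alice y x) i.succ (alice a) := by
  unfold hardInput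
  rw [← Fin.cons_update]
  congr 1
  ext j
  by_cases hj : j = i
  · subst hj; simp
  · simp [hj]

section ErrorBound

variable {α : Type*} [DecidableEq α] [Fintype α] {X : Type} {m : ℕ}

/-- A deterministic protocol that exchanges few bits makes many errors. -/
theorem Protocol.sum_error_ge (h100 : 100 ≤ Fintype.card α) (P : Protocol (m + 1) X) (C L : ℕ)
    (bob alice : Finset α → X)
    (hlen : ∀ y x, (P.transcript (hardInput bob alice y x) C).length ≤ C)
    {err : Finset α → (Fin m → Finset α) → Prop}
    (h0 : ∀ y x, (∀ i, Disjoint (x i) y) → ¬ err y x →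
      P.answerAt C (hardInput bob alice y x) = true)
    (h1 : ∀ y x i, (x i ∩ y).card = 1 → ¬ err y x →
      ¬ P.answerAt C (hardInput bob alice y x) = true) :
    9 / 10 * (m - 2 * C / (L + 1)) -
        m * (2 * (2 * (m + 1) ^ 2 + 1) ^ L * Real.exp (-(Fintype.card α / 2000 : ℝ))) ≤
      ∑ i, replacedMean uniqueWeight i (fun y x => indicatorOf (err y x)) +
        m * disjointMean (fun y (x : Fin m → Finset α) => indicatorOf (err y x)) := by
  obtain ⟨N, hN, hNcard⟩ := exists_finset_views (m + 1) L
  set E := Real.exp (-(Fintype.card α / 2000 : ℝ))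
  have hE : 0 < E := Real.exp_pos _
  set G := hardInput (m := m) bob alice
  let view : Fin m → Finset α → (Fin m → Finset α) → List (Message (m + 1)) := fun i y x =>
    localView i.succ (P.transcript (G y x) C)
  -- The classes by view and reporter flag, restricted to positive answers: each is a rectangle for
  -- site i, and those with short views partition `good`.
  let R : Fin m → List (Message (m + 1)) × Bool → Finset α → (Fin m → Finset α) → Prop :=
    fun i l y x => view i y x = l.1 ∧
      decide (P.reporter (P.transcript (G y x) C) = i.succ) = l.2 ∧
      P.answerAt C (G y x) = true
  let good : Fin m → Finset α → (Fin m → Finset α) → Prop := fun i y x =>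
    P.answerAt C (G y x) = true ∧ (view i y x).length ≤ L
  have hgood : ∀ i y x, indicatorOf (good i y x) =
      ∑ l ∈ N ×ˢ Finset.univ, indicatorOf (R i l y x) := by
    intro i y x
    set l₀ := (view i y x, decide (P.reporter (P.transcript (G y x) C) = i.succ))
    by_cases hg : good i y x
    · rw [Finset.sum_eq_single l₀]
      · simp [indicatorOf, R, hg, l₀, hg.1]
      · intro l _ hl
        refine if_neg fun h => hl (Prod.ext h.1.symm h.2.1.symm)
      · intro h
        exact absurd (Finset.mem_product.2 ⟨(hN _).2 hg.2, Finset.mem_univ _⟩) h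
    · rw [Finset.sum_eq_zero]
      · exact if_neg hg
      · intro l hl
        refine if_neg fun h => hg ⟨h.2.2, ?_⟩
        rw [h.1]
        exact (hN _).1 (Finset.mem_product.1 hl).1
  have hrect : ∀ i l, 9 / 10 * disjointMean (fun y x => indicatorOf (R i l y x)) - E ≤
      replacedMean uniqueWeight i (fun y x => indicatorOf (R i l y x)) := by
    intro i l
    refine replacedMean_ge_of_rectangle h100 i fun y x a y' x' a' hu hv => ?_
    have hw : G y' (Function.update x' i a) =
        Function.update (G y' (Function.update x' i a')) i.succ
          (G y (Function.update x i a) i.succ) := by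
      simp only [G, hardInput_update, Function.update_idem, Function.update_self]
    have hview := hu.1.trans hv.1.symm
    have hrep : P.reporter (P.transcript (G y (Function.update x i a)) C) = i.succ ↔
        P.reporter (P.transcript (G y' (Function.update x' i a')) C) = i.succ :=
      decide_eq_decide.1 (hu.2.1.trans hv.2.1.symm)
    have ht := P.transcript_update hview le_rfl
    have hans := P.answerAt_update hview hrep (hu.2.2.trans hv.2.2.symm)
    rw [← hw] at ht hans
    refine ⟨?_, ?_, hans.trans hv.2.2⟩
    · change localView _ _ = _
      rw [ht]
      exact hv.1
    · rw [ht]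
      exact hv.2.1
  -- A positive answer on a uniquely intersecting input is an error, so the corrupted mass of all
  -- short-view rectangles is error mass. The leading factor 2 counts the reporter flag.
  have hsite : ∀ i, 9 / 10 * disjointMean (fun y x => indicatorOf (good i y x)) -
      2 * (2 * (m + 1) ^ 2 + 1) ^ L * E ≤
      replacedMean uniqueWeight i (fun y x => indicatorOf (err y x)) := by
    intro i
    have hm : replacedMean uniqueWeight i (fun y x => indicatorOf (good i y x)) ≤
        replacedMean uniqueWeight i (fun y x => indicatorOf (err y x)) :=
      replacedMean_uniqueWeight_mono i fun y x hc => indicatorOf_mono fun hg => by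
        by_contra he
        exact h1 y x i hc he hg.1
    refine le_trans ?_ hm
    simp_rw [hgood]
    rw [disjointMean_sum, replacedMean_sum, Finset.mul_sum]
    refine le_trans ?_ (Finset.sum_le_sum fun l _ => hrect i l)
    rw [Finset.sum_sub_distrib, Finset.sum_const, nsmul_eq_mul, Finset.card_product]
    have : ((N.card * (Finset.univ : Finset Bool).card : ℕ) : ℝ) ≤
        2 * (2 * (m + 1) ^ 2 + 1) ^ L := by
      have : N.card * (Finset.univ : Finset Bool).card ≤ 2 * (2 * (m + 1) ^ 2 + 1) ^ L := by
        rw [Finset.card_univ, Fintype.card_bool]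
        omega
      exact_mod_cast this
    have := mul_le_mul_of_nonneg_right this hE.le
    linarith
  -- Markov's inequality on the view lengths: outside the error event the answer is positive, so
  -- only a view longer than L keeps a site from being good.
  have hlower : (m : ℝ) - 2 * C / (L + 1) ≤
      ∑ i, disjointMean (fun y x => indicatorOf (good i y x)) +
        m * disjointMean (fun y (x : Fin m → Finset α) => indicatorOf (err y x)) := by
    have e1 : ∑ i, disjointMean (fun y x => indicatorOf (good i y x)) +
        m * disjointMean (fun y (x : Fin m → Finset α) => indicatorOf (err y x)) =
        disjointMean (fun y x => ∑ i : Fin m,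
          (indicatorOf (good i y x) + indicatorOf (err y x))) := by
      rw [disjointMean_sum]
      simp_rw [disjointMean_add]
      rw [Finset.sum_add_distrib, Finset.sum_const, Finset.card_univ, Fintype.card_fin,
        nsmul_eq_mul]
    rw [e1, ← disjointMean_const (α := α) (ι := Fin m) ((m : ℝ) - 2 * C / (L + 1))]
    refine disjointMean_mono fun y x hd => ?_
    have hL : (0 : ℝ) < L + 1 := by positivity
    have hi : ∀ i, 1 - ((view i y x).length : ℝ) / (L + 1) ≤
        indicatorOf (good i y x) + indicatorOf (err y x) := by
      intro i
      have hq : 0 ≤ ((view i y x).length : ℝ) / (L + 1) := by positivity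
      have hg0 := indicatorOf_nonneg (good i y x)
      have he0 := indicatorOf_nonneg (err y x)
      by_cases he : err y x
      · have : indicatorOf (err y x) = 1 := if_pos he
        linarith
      · have ha := h0 y x hd he
        by_cases hl : (view i y x).length ≤ L
        · have : indicatorOf (good i y x) = 1 := if_pos ⟨ha, hl⟩
          linarith
        · have : (1 : ℝ) ≤ ((view i y x).length : ℝ) / (L + 1) := by
            rw [one_le_div hL]
            exact_mod_cast (by omega : L + 1 ≤ (view i y x).length)
          linarith
    refine le_trans ?_ (Finset.sum_le_sum fun i _ => hi i)
    rw [Finset.sum_sub_distrib, ← Finset.sum_div, Finset.sum_const, Finset.card_univ,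
      Fintype.card_fin, nsmul_eq_mul, mul_one]
    have hs : ∑ i, (view i y x).length ≤ 2 * C := by
      have h2 := Protocol.sum_length_localView_le (P.transcript (G y x) C)
      rw [Fin.sum_univ_succ] at h2
      have h3 : ∑ i, (view i y x).length =
        ∑ i : Fin m, (localView i.succ (P.transcript (G y x) C)).length := rfl
      have := hlen y x
      omega
    have hs' : ∑ i, ((view i y x).length : ℝ) ≤ 2 * C := by exact_mod_cast hs
    gcongr
  have hsum := Finset.sum_le_sum fun i (_ : i ∈ (Finset.univ : Finset (Fin m))) => hsite i
  rw [Finset.sum_sub_distrib, ← Finset.mul_sum, Finset.sum_const, Finset.card_univ,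
    Fintype.card_fin, nsmul_eq_mul] at hsum
  have hD : 0 ≤ m * disjointMean (fun y (x : Fin m → Finset α) => indicatorOf (err y x)) := by
    refine mul_nonneg (Nat.cast_nonneg m) ?_
    rw [← disjointMean_const (α := α) (ι := Fin m) 0]
    exact disjointMean_mono fun _ _ _ => indicatorOf_nonneg _
  linarith

theorem integrable_indicatorOf {Ω : Type*} [MeasurableSpace Ω] {μ : Measure Ω}
    [IsFiniteMeasure μ] {S : Set Ω} (hS : MeasurableSet S) :
    Integrable (fun ω => indicatorOf (ω ∈ S)) μ :=
  (integrable_const (1 : ℝ)).indicator hS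

theorem integral_indicatorOf {Ω : Type*} [MeasurableSpace Ω] {μ : Measure Ω}
    {S : Set Ω} (hS : MeasurableSet S) : ∫ ω, indicatorOf (ω ∈ S) ∂μ = μ.real S :=
  integral_indicator_one hS

/-- A randomized protocol with error `1 / 3` on the hard inputs exchanges many bits. -/
theorem RandomizedProtocol.views_gt_of_computesWithError (h100 : 100 ≤ Fintype.card α)
    (hm : 0 < m) (P : RandomizedProtocol (m + 1) X) {inputs : Set (Fin (m + 1) → X)}
    {f : (Fin (m + 1) → X) → Prop} (bob alice : Finset α → X)
    (hin : ∀ y x, hardInput (m := m) bob alice y x ∈ inputs)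
    (h0 : ∀ y x, (∀ i, Disjoint (x i) y) → f (hardInput (m := m) bob alice y x))
    (h1 : ∀ y x i, (x i ∩ y).card = 1 → ¬ f (hardInput (m := m) bob alice y x))
    (hP : P.ComputesWithError inputs f (1 / 3)) {C L : ℕ} (hC : P.cost inputs ≤ C)
    (hL : 20 * C ≤ m * (L + 1)) :
    1 < 20 * ((2 * (m + 1) ^ 2 + 1) ^ L * Real.exp (-(Fintype.card α / 2000 : ℝ))) := by
  have : Nonempty α := Fintype.card_pos_iff.1 (by omega)
  set G := hardInput (m := m) bob alice
  have hcost : ∀ ω y x, (P.fixTapes ω).cost (G y x) ≤ C := fun ω y x =>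
    le_trans (le_trans (le_iSup (fun ω => (P.fixTapes ω).cost (G y x)) ω)
      (le_iSup₂ (f := fun x (_ : x ∈ inputs) => ⨆ ω : P.Ω, (P.fixTapes ω).cost x) (G y x)
        (hin y x))) hC
  -- The error events need not be measurable; measurable hulls have the same measure and contain
  -- them.
  let S : Finset α → (Fin m → Finset α) → Set P.Ω := fun y x =>
    toMeasurable P.law {ω | ¬ (P.fixTapes ω).Correct f (G y x)}
  have hS : ∀ y x, MeasurableSet (S y x) := fun y x => measurableSet_toMeasurable _ _
  have hcorrect : ∀ ω y x, ω ∉ S y x →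
      ((P.fixTapes ω).answerAt C (G y x) = true ↔ f (G y x)) := by
    intro ω y x hω
    refine (P.fixTapes ω).answerAt_of_correct (hcost ω y x) ?_
    by_contra h
    exact hω (subset_toMeasurable _ _ h)
  have hSle : ∀ y x, P.law.real (S y x) ≤ 1 / 3 := by
    intro y x
    have h : P.law (S y x) ≤ 1 / 3 := (measure_toMeasurable _).le.trans (hP (G y x) (hin y x))
    have h3 := ENNReal.toReal_mono (by simp) h
    rw [measureReal_def]
    simpa using h3
  have hbound := fun ω => (P.fixTapes ω).sum_error_ge h100 C L bob alice
    (fun y x => (P.fixTapes ω).length_transcript_le_of_cost_le (hcost ω y x) C)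
    (err := fun y x => ω ∈ S y x)
    (fun y x hd hω => (hcorrect ω y x hω).2 (h0 y x hd))
    (fun y x i hc hω ha => h1 y x i hc ((hcorrect ω y x hω).1 ha))
  set ρ := 9 / 10 * ((m : ℝ) - 2 * C / (L + 1)) -
        m * (2 * (2 * (m + 1) ^ 2 + 1) ^ L * Real.exp (-(Fintype.card α / 2000 : ℝ)))
  have hint : ∀ y x, Integrable (fun ω => indicatorOf (ω ∈ S y x)) P.law := fun y x =>
    integrable_indicatorOf (hS y x)
  have hi1 := fun i : Fin m => integrable_replacedMean uniqueWeight i hint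
  have hi2 := integrable_disjointMean hint
  have hmean : ρ ≤ ∑ i, replacedMean uniqueWeight i (fun y x => P.law.real (S y x)) +
      m * disjointMean (fun y x => P.law.real (S y x)) := by
    have h := integral_mono (integrable_const ρ)
      ((integrable_finsetSum Finset.univ fun i _ => hi1 i).add (hi2.const_mul (m : ℝ))) hbound
    rw [integral_const, probReal_univ, one_smul] at h
    refine h.trans_eq ?_
    simp only [Pi.add_apply]
    rw [integral_add (integrable_finsetSum Finset.univ fun i _ => hi1 i)
      (hi2.const_mul (m : ℝ)), integral_finsetSum _ fun i _ => hi1 i, integral_const_mul,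
      integral_disjointMean hint]
    simp_rw [integral_replacedMean uniqueWeight _ hint, integral_indicatorOf (hS _ _)]
  have hle1 : ∀ i : Fin m, replacedMean uniqueWeight i (fun y x => P.law.real (S y x)) ≤ 1 / 3 :=
    fun i => (replacedMean_uniqueWeight_mono i fun y x _ => hSle y x).trans_eq
      (replacedMean_uniqueWeight_const i _)
  have hle2 : disjointMean (fun y x => P.law.real (S y x)) ≤ 1 / 3 :=
    (disjointMean_mono fun y x _ => hSle y x).trans_eq (disjointMean_const _)
  have hle3 := Finset.sum_le_sum fun i (_ : i ∈ (Finset.univ : Finset (Fin m))) => hle1 i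
  rw [Finset.sum_const, Finset.card_univ, Fintype.card_fin, nsmul_eq_mul] at hle3
  have hm' : (0 : ℝ) < m := by exact_mod_cast hm
  have hC' : 2 * (C : ℝ) / (L + 1) ≤ m / 10 := by
    have : (20 * C : ℝ) ≤ m * (L + 1) := by exact_mod_cast hL
    rw [div_le_iff₀ (by positivity)]
    linarith
  set T : ℝ := (2 * (m + 1) ^ 2 + 1) ^ L * Real.exp (-(Fintype.card α / 2000 : ℝ))
  have hρ : ρ = 9 / 10 * ((m : ℝ) - 2 * C / (L + 1)) - m * (2 * T) := by
    simp only [ρ, T]; ring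
  by_contra hT
  push Not at hT
  -- If T ≤ 1/20, the lower bound is at least (81/100 - 1/10) m, while errors at most 1/3 under both
  -- distributions allow only (2/3) m.
  nlinarith

end ErrorBound

/-! ### Choice of the parameters and conclusion -/

theorem exists_cost_le_of_randomizedCC_eq {k : ℕ} {X : Type} {δ : ℝ≥0∞}
    {inputs : Set (Fin k → X)} {f : (Fin k → X) → Prop} {C : ℕ}
    (h : randomizedCC δ inputs f = C) :
    ∃ P : RandomizedProtocol k X, P.ComputesWithError inputs f δ ∧ P.cost inputs ≤ C := by
  have hlt : randomizedCC δ inputs f < ((C + 1 : ℕ) : ℕ∞) := by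
    rw [h]
    exact_mod_cast Nat.lt_succ_self C
  unfold randomizedCC at hlt
  obtain ⟨P, hP⟩ := iInf_lt_iff.1 hlt
  obtain ⟨hP1, hP2⟩ := iInf_lt_iff.1 hP
  refine ⟨P, hP1, ?_⟩
  push_cast at hP2
  exact Order.le_of_lt_add_one hP2

/-- Since 2k² + 1 ≤ k³, the count of views is at most exp(3L log k) ≤ exp(n/16000), half the
exponent n/8000 that r/2000 provides up to rounding. For n ≥ 100000 the gap also covers 20 ≤ e⁵. -/
theorem views_mul_exp_le {k n r L : ℕ} (hk : 3 ≤ k) (hn : 100000 ≤ n) (hr : n / 4 = r)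
    (hL : L * Real.logb 2 k ≤ n / 48000) :
    20 * ((2 * (k : ℝ) ^ 2 + 1) ^ L * Real.exp (-(r / 2000 : ℝ))) ≤ 1 := by
  have hk' : (3 : ℝ) ≤ k := by exact_mod_cast hk
  have hn' : (100000 : ℝ) ≤ n := by exact_mod_cast hn
  have hr' : (n : ℝ) / 4 - 1 ≤ r := by
    have : n ≤ 4 * r + 4 := by omega
    have : (n : ℝ) ≤ 4 * r + 4 := by exact_mod_cast this
    linarith
  have h1 : (2 * (k : ℝ) ^ 2 + 1) ≤ (k : ℝ) ^ 3 := by nlinarith [sq_nonneg (k : ℝ)]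
  have hlog : Real.log k ≤ Real.logb 2 k := by
    rw [Real.logb, le_div_iff₀ (Real.log_pos (by norm_num))]
    have := Real.log_two_lt_d9
    have := Real.log_nonneg (by linarith : (1 : ℝ) ≤ k)
    nlinarith
  have h2 : (2 * (k : ℝ) ^ 2 + 1) ^ L ≤ Real.exp (n / 16000) := by
    calc (2 * (k : ℝ) ^ 2 + 1) ^ L ≤ ((k : ℝ) ^ 3) ^ L := by gcongr
      _ = Real.exp (3 * L * Real.log k) := by
        rw [← pow_mul, mul_comm, ← Real.exp_log (by linarith : (0 : ℝ) < k), ← Real.exp_nat_mul,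
          Real.log_exp]
        push_cast
        ring_nf
      _ ≤ Real.exp (n / 16000) := by
        refine Real.exp_le_exp.2 ?_
        have : (L : ℝ) * Real.log k ≤ L * Real.logb 2 k := by gcongr
        linarith
  have h3 : (20 : ℝ) ≤ Real.exp 5 := by
    have := Real.exp_one_gt_d9
    calc (20 : ℝ) ≤ 2 ^ 5 := by norm_num
      _ ≤ Real.exp 1 ^ 5 := by gcongr; linarith
      _ = Real.exp 5 := by rw [← Real.exp_nat_mul]; norm_num
  calc 20 * ((2 * (k : ℝ) ^ 2 + 1) ^ L * Real.exp (-(r / 2000 : ℝ)))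
      ≤ Real.exp 5 * (Real.exp (n / 16000) * Real.exp (-(r / 2000 : ℝ))) := by gcongr
    _ = Real.exp (5 + (n / 16000 + -(r / 2000 : ℝ))) := by rw [Real.exp_add, Real.exp_add]
    _ ≤ 1 := by
      rw [Real.exp_le_one_iff]
      linarith

theorem mainTheorem8 :
    ∃ c₀ : ℝ, 0 < c₀ ∧ ∃ c : ℝ, 0 < c ∧
      ∀ k n : ℕ, 2 ≤ k → c₀ * Real.logb 2 n ≤ k → k ≤ n →
        ENNReal.ofReal (c * (k * n / Real.logb 2 k)) ≤
          ((randomizedCC (1 / 3) (graphInputs k n) (Bipartiteness k n) : ℕ∞) : ℝ≥0∞) := by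
  -- As log₂ n ≥ 1, this c₀ forces n ≥ k ≥ 100000, large enough for every numerical estimate. And
  -- 1920000 = 40 · 48000, where 40 comes from the 20 in L and from k ≤ 2m.
  refine ⟨100000, by norm_num, 1 / 1920000, by norm_num, fun k n hk2 hkn hk => ?_⟩
  have hlogn : 1 ≤ Real.logb 2 n := by
    rw [Real.le_logb_iff_rpow_le (by norm_num) (by exact_mod_cast (by omega : 0 < n))]
    simpa using (by exact_mod_cast hk2.trans hk : (2 : ℝ) ≤ n)
  have hk5 : (100000 : ℝ) ≤ k := by linarith
  have hk5' : 100000 ≤ k := by exact_mod_cast hk5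
  have hlogk : 1 ≤ Real.logb 2 k := by
    rw [Real.le_logb_iff_rpow_le (by norm_num) (by positivity)]
    simp only [Real.rpow_one]
    linarith
  by_contra hlt
  push Not at hlt
  obtain ⟨C, hC⟩ : ∃ C : ℕ,
      randomizedCC (1 / 3) (graphInputs k n) (Bipartiteness k n) = C := by
    refine ENat.ne_top_iff_exists.1 (fun h => ?_) |>.imp fun _ h => h.symm
    rw [h] at hlt
    simp at hlt
  obtain ⟨P, hP, hcost⟩ := exists_cost_le_of_randomizedCC_eq hC
  rw [hC] at hlt
  have hClt : (C : ℝ) < 1 / 1920000 * (k * n / Real.logb 2 k) := by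
    by_contra h
    push Not at h
    refine absurd hlt (not_lt.2 ?_)
    refine (ENNReal.ofReal_le_ofReal h).trans ?_
    simp
  obtain ⟨m, rfl⟩ : ∃ m, k = m + 1 := ⟨k - 1, by omega⟩
  -- The length threshold is L = ⌊20C/m⌋, so on average at most a tenth of the sites have longer
  -- views.
  have hL : 20 * C ≤ m * (20 * C / m + 1) := by
    have := Nat.lt_mul_div_succ (20 * C) (by omega : 0 < m)
    exact this.le
  have hLlog : ((20 * C / m : ℕ) : ℝ) * Real.logb 2 ((m + 1 : ℕ) : ℝ) ≤ n / 48000 := by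
    have hm : (0 : ℝ) < m := by exact_mod_cast (by omega : 0 < m)
    have h1 : ((20 * C / m : ℕ) : ℝ) * m ≤ 20 * C := by
      exact_mod_cast Nat.div_mul_le_self (20 * C) m
    have h2 : (C : ℝ) * Real.logb 2 ((m + 1 : ℕ) : ℝ) ≤ 1 / 1920000 * (((m + 1 : ℕ) : ℝ) * n) := by
      rw [mul_div_assoc', lt_div_iff₀ (by linarith)] at hClt
      exact hClt.le
    have h3 : (((m + 1 : ℕ) : ℝ)) ≤ 2 * m := by exact_mod_cast (by omega : m + 1 ≤ 2 * m)
    refine le_of_mul_le_mul_right ?_ hm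
    calc _ = ((20 * C / m : ℕ) : ℝ) * m * Real.logb 2 ((m + 1 : ℕ) : ℝ) := by ring
      _ ≤ 20 * C * Real.logb 2 ((m + 1 : ℕ) : ℝ) := by gcongr
      _ ≤ 20 * (1 / 1920000 * (((m + 1 : ℕ) : ℝ) * n)) := by linarith
      _ ≤ 20 * (1 / 1920000 * ((2 * m) * n)) := by gcongr
      _ ≤ n / 48000 * m := by linarith
  have hsmall := views_mul_exp_le (by omega) (by omega) rfl hLlog
  have hbig := P.views_gt_of_computesWithError (α := Fin (n / 4))
    (by rw [Fintype.card_fin]; omega) (by omega) (bobGraph n) (aliceGraph n)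
    (fun y x => hardInput_mem_graphInputs (by omega) (by omega))
    (fun y x h => bipartiteness_of_disjoint h)
    (fun y x i h => by
      obtain ⟨j, hj⟩ := Finset.card_pos.1 (by omega : 0 < (x i ∩ y).card)
      exact not_bipartiteness_of_mem (by omega) (Finset.mem_inter.1 hj).1 (Finset.mem_inter.1 hj).2)
    hP hcost hL
  rw [Fintype.card_fin] at hbig
  push_cast at hsmall hbig
  linarith
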